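/- Let $N,d\ge 1$ be integers and $t\in\mathbb{R}$. For $V:\mathbb{C}\to\mathbb{R}$ and $n\ge1$ put $$\mathcal Z_n[V]=\int_{\mathbb{C}^n}\prod_{j=1}^{n}e^{-nV(\lambda_j)}\prod_{1\le i<j\le n}|\lambda_j-\lambda_i|^2\,d^2\lambda_1\cdots d^2\lambda_n ,$$ and let $\mathcal Z^{(\mathrm{Lem}_d)}_{n}(t)=\mathcal Z_n[V]$ with $V(\lambda)=|\lambda|^{2d}-t(\lambda^d+\overline{\lambda}^{\,d})$ and $\mathcal Z^{(\mathrm{Gin})}_{n}=\mathcal Z_n[V]$ with $V(\lambda)=|\lambda|^2$. Let $G_N=N^{-1/2}G$, where $G$ is an $N\times N$ matrix with i.i.d. standard complex normal entries (density $\pi^{-1}e^{-|z|^2}$ on $\mathbb{C}$). Set $$\gamma_\ell=-2\Big(1-\frac{\ell+1}{d}\Big)\quad(\ell=0,\dots,d-1),\qquad c_{N,d}=(Nd)!\,d^{-N(Nd+2d+1)/2}\,(N!)^{-d}.$$ Then the integrals defining $\mathcal Z^{(\mathrm{Lem}_d)}_{Nd}(t)$ and $\mathcal Z^{(\mathrm{Gin})}_{N}$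 and all the expectations below are finite, and $$\mathcal Z^{(\mathrm{Lem}_d)}_{Nd}(t)=e^{(Ntd)^2}\,c_{N,d}\,\big(\mathcal Z^{(\mathrm{Gin})}_{N}\big)^{d}\prod_{\ell=0}^{d-1}\mathbb E\big(|\det(G_N-t\sqrt d)|^{\gamma_\ell}\big),$$ where $$\mathcal Z^{(\mathrm{Gin})}_{N}=\pi^N\,\frac{\prod_{k=1}^{N}k!}{N^{N(N+1)/2}} .$$ -/

import Mathlib

open MeasureTheory

noncomputable section

namespace Lemniscate

/-- The unnormalised joint density `∏ⱼ exp(-n V(λⱼ)) ∏_{i<j} |λⱼ - λᵢ|²` of the normal matrix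
model with `n` points and external potential `V`. -/
def weight (n : ℕ) (V : ℂ → ℝ) (z : Fin n → ℂ) : ℝ :=
  (∏ j, Real.exp (-(n : ℝ) * V (z j))) * ∏ i, ∏ j ∈ Finset.Ioi i, ‖z j - z i‖ ^ 2

/-- The partition function of the normal matrix model: the integral of `weight n V` over `ℂⁿ`
with respect to Lebesgue measure. -/
def partitionFunction (n : ℕ) (V : ℂ → ℝ) : ℝ :=
  ∫ z : Fin n → ℂ, weight n V z

/-- The potential `|λ|²` of the complex Ginibre ensemble. -/
def ginibrePotential (z : ℂ) : ℝ := ‖z‖ ^ 2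

/-- The lemniscate potential `|λ|^{2d} - t (λ^d + conj(λ)^d)`; the bracket is real, which is why
taking its real part changes nothing. -/
def lemniscatePotential (d : ℕ) (t : ℝ) (z : ℂ) : ℝ :=
  ‖z‖ ^ (2 * d) - t * (z ^ d + (starRingEnd ℂ z) ^ d).re

/-- The law of a standard complex normal variable: density `π⁻¹ exp(-|z|²)` on `ℂ`. -/
def stdComplexNormal : Measure ℂ :=
  volume.withDensity fun z => ENNReal.ofReal (Real.pi⁻¹ * Real.exp (-‖z‖ ^ 2))

/-- The joint law of the i.i.d. standard complex normal entries of an `N × N` matrix `G`. -/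
def gaussianEntries (N : ℕ) : Measure (Fin N × Fin N → ℂ) :=
  Measure.pi fun _ => stdComplexNormal

/-- The matrix `G_N = N^{-1/2} G` with the prescribed entries of `G`. -/
def ginibreMatrix (N : ℕ) (g : Fin N × Fin N → ℂ) : Matrix (Fin N) (Fin N) ℂ :=
  Matrix.of fun i j => g (i, j) / (Real.sqrt N : ℂ)

/-- The random variable `|det (G_N - z)|^γ`. -/
def absDetPow (N : ℕ) (γ : ℝ) (z : ℂ) (g : Fin N × Fin N → ℂ) : ℝ :=
  ‖(ginibreMatrix N g - z • (1 : Matrix (Fin N) (Fin N) ℂ)).det‖ ^ γ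

/-- The expectation `𝔼 |det (G_N - z)|^γ` for a standard complex Ginibre matrix `G_N`. -/
def ginibreMoment (N : ℕ) (γ : ℝ) (z : ℂ) : ℝ :=
  ∫ g, absDetPow N γ z g ∂(gaussianEntries N)

/-- The exponent `γ_ℓ = -2 (1 - (ℓ + 1) / d)`. -/
def gammaExponent (d ℓ : ℕ) : ℝ := -2 * (1 - ((ℓ : ℝ) + 1) / d)

/-- The constant `c_{N,d} = (Nd)! d^{-N(Nd+2d+1)/2} (N!)^{-d}`. -/
def reductionConstant (N d : ℕ) : ℝ :=
  ((N * d).factorial : ℝ) * (d : ℝ) ^ (-((N : ℝ) * (N * d + 2 * d + 1) / 2)) *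
    ((N.factorial : ℝ) ^ d)⁻¹

end Lemniscate

end

/-! Completing the square gives V(λ) = |λ^d - t|² - t², so the weight is invariant under
multiplication of λ by d-th roots of unity. Andréief's identity writes the partition function as
(Nd)! times the determinant of the moment matrix; the symmetry kills the moment (j, k) unless j ≡ k
mod d, so with j = ℓ + d a the matrix splits into d blocks of size N
(`partitionFunction_lemniscate_eq_prod`). In block ℓ the substitution u = λ^d produces the moments
of |u|^γ exp(-Nd|u - t|²) with γ = γ_ℓ, where the Jacobian accounts for the exponent
(`lemniscate_moment_diag`). Andréief read backwards turns each block into an N-point integral, and u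
= t - v/√d makes it the Ginibre eigenvalue integral of ∏ |v_j - t√d|^γ (`shiftedPartition_eq`).

It remains to identify that integral with the expectation of |det(G_N - t√d)|^γ, that is, to derive
the Ginibre eigenvalue law. This is done without Schur decomposition. Split a matrix of size n + 1
into corner a, row w, column c and block D. For fixed D, w, c the eigenvalue equation at x can be
solved for a as a rational function of x of degree n + 1. Its area formula replaces a by x, each
matrix being counted n + 1 times; then c = (x - D)q introduces the eigenvector (1, q), and D = B + q
⊗ w the quotient B. The Jacobians combine to |det(x - B)|² (`lintegral_eigBlk`).

A unitary frame adapted to (1, q) makes the Gaussian weight factor: the row w integrates out, and B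
appears up to a similarity, which does not affect characteristic polynomials
(`exists_lintegral_gaussDensity_eigBlk`). Induction on the size then yields the squared Vandermonde,
the factor |det(x - B)|² being absorbed into the test function (`exists_lintegral_listDet`). The
constants are never computed: they do not depend on γ, and γ = 0 fixes them through the Ginibre
partition function (`lintegral_absDetPow`). -/

namespace Lemniscate

/-! ### Area formula for rational functions of one complex variable. -/

section AreaFormula

open scoped ENNReal Topology
open Set Polynomial

/-- The real Jacobian of a complex-linear endomorphism is the squared modulus of its determinant. -/
lemma abs_det_restrictScalars {E : Type*} [AddCommGroup E] [Module ℂ E]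
    (f : E →ₗ[ℂ] E) :
    |LinearMap.det (f.restrictScalars ℝ)| = ‖LinearMap.det f‖ ^ 2 := by
  rw [LinearMap.det_restrictScalars, Algebra.norm_complex_eq]
  simp [Complex.normSq_eq_norm_sq]

lemma exists_isOpen_injOn_of_hasStrictDerivAt {f : ℂ → ℂ} {f' x : ℂ}
    (hf : HasStrictDerivAt f f' x) (hne : f' ≠ 0) :
    ∃ V : Set ℂ, IsOpen V ∧ x ∈ V ∧ InjOn f V := by
  have h := hf.hasStrictFDerivAt_equiv hne
  exact ⟨(h.toOpenPartialHomeomorph f).source, (h.toOpenPartialHomeomorph f).open_source,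
    h.mem_toOpenPartialHomeomorph_source, (h.toOpenPartialHomeomorph f).injOn⟩

lemma exists_countable_injOn_cover {f : ℂ → ℂ} {U : Set ℂ}
    (h : ∀ x ∈ U, ∃ V : Set ℂ, IsOpen V ∧ x ∈ V ∧ InjOn f V) :
    ∃ V : ℕ → Set ℂ, (∀ n, IsOpen (V n)) ∧ (∀ n, InjOn f (V n)) ∧ U ⊆ ⋃ n, V n := by
  choose! W hWo hWm hWi using h
  obtain ⟨t, htU, htc, hcov⟩ := TopologicalSpace.countable_cover_nhdsWithin (s := U) (f := W)
    fun x hx => mem_nhdsWithin_of_mem_nhds ((hWo x hx).mem_nhds (hWm x hx))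
  rcases t.eq_empty_or_nonempty with rfl | hne
  · exact ⟨fun _ => ∅, fun _ => isOpen_empty, fun _ => injOn_empty _, by simpa using hcov⟩
  · obtain ⟨g, rfl⟩ := htc.exists_eq_range hne
    refine ⟨fun n => W (g n), fun n => hWo _ (htU ⟨n, rfl⟩), fun n => hWi _ (htU ⟨n, rfl⟩), ?_⟩
    simpa using hcov

/-- Area formula for a holomorphic map all of whose generic fibres have `N` points. -/
theorem setLIntegral_comp_mul_deriv_sq {f f' : ℂ → ℂ} {U : Set ℂ} (hU : MeasurableSet U)
    (hf : ∀ x ∈ U, HasStrictDerivAt f (f' x) x) (hne : ∀ x ∈ U, f' x ≠ 0) {N : ℕ}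
    (hN : ∀ᵐ a, (U ∩ f ⁻¹' {a}).encard = N) (h : ℂ → ℝ≥0∞) (hh : Measurable h) :
    ∫⁻ x in U, ENNReal.ofReal (‖f' x‖ ^ 2) * h (f x) = N * ∫⁻ a, h a := by
  obtain ⟨V, hVo, hVi, hcov⟩ := exists_countable_injOn_cover (f := f) (U := U)
    fun x hx => exists_isOpen_injOn_of_hasStrictDerivAt (hf x hx) (hne x hx)
  -- Disjoint measurable pieces on which `f` is injective: change of variables applies to each, and
  -- summing the indicators of the images counts the points of a fibre.
  set E : ℕ → Set ℂ := fun n => U ∩ disjointed V n with hE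
  have hEm : ∀ n, MeasurableSet (E n) := fun n =>
    hU.inter (MeasurableSet.disjointed (fun i => (hVo i).measurableSet) n)
  have hEd : Pairwise (Function.onFun Disjoint E) := fun i j hij =>
    ((disjoint_disjointed V) hij).mono inter_subset_right inter_subset_right
  have hEU : ⋃ n, E n = U := by
    rw [hE, ← inter_iUnion, iUnion_disjointed]
    exact inter_eq_left.2 hcov
  have hEi : ∀ n, InjOn f (E n) := fun n =>
    (hVi n).mono (inter_subset_right.trans (disjointed_subset V n))
  have hder : ∀ n, ∀ x ∈ E n, HasFDerivWithinAt f
      ((ContinuousLinearMap.toSpanSingleton ℂ (f' x)).restrictScalars ℝ) (E n) x :=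
    fun n x hx => ((hf x hx.1).hasDerivAt.hasFDerivAt.restrictScalars ℝ).hasFDerivWithinAt
  have hdet : ∀ x, |((ContinuousLinearMap.toSpanSingleton ℂ (f' x)).restrictScalars ℝ).det| =
      ‖f' x‖ ^ 2 := by
    intro x
    have := abs_det_restrictScalars ((ContinuousLinearMap.toSpanSingleton ℂ (f' x)) : ℂ →ₗ[ℂ] ℂ)
    rw [LinearMap.det_ring] at this
    simpa [ContinuousLinearMap.det] using this
  have hpiece : ∀ n, ∫⁻ x in E n, ENNReal.ofReal (‖f' x‖ ^ 2) * h (f x) =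
      ∫⁻ a, (f '' E n).indicator h a := by
    intro n
    rw [lintegral_indicator (measurable_image_of_fderivWithin (hEm n) (hder n) (hEi n)),
      lintegral_image_eq_lintegral_abs_det_fderiv_mul volume (hEm n) (hder n) (hEi n)]
    simp_rw [hdet]
  have hcount : ∀ n a, (f '' E n).indicator h a =
      Measure.count (E n ∩ f ⁻¹' {a}) * h a := by
    intro n a
    by_cases ha : a ∈ f '' E n
    · obtain ⟨x, hx, rfl⟩ := ha
      have : E n ∩ f ⁻¹' {f x} = {x} := by
        ext y
        constructor
        · rintro ⟨hy, hyx⟩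
          exact hEi n hy hx hyx
        · rintro rfl
          exact ⟨hx, rfl⟩
      rw [indicator_of_mem (mem_image_of_mem f hx), this, Measure.count_singleton, one_mul]
    · have : E n ∩ f ⁻¹' {a} = ∅ := by
        ext y
        simp only [mem_inter_iff, mem_preimage, mem_singleton_iff, mem_empty_iff_false, iff_false]
        exact fun hy => ha ⟨y, hy⟩
      rw [indicator_of_notMem ha, this, measure_empty, zero_mul]
  rw [← hEU, lintegral_iUnion hEm hEd]
  simp_rw [hpiece]
  rw [← lintegral_tsum fun n => (hh.indicator
    (measurable_image_of_fderivWithin (hEm n) (hder n) (hEi n))).aemeasurable,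
    ← lintegral_const_mul _ hh]
  refine lintegral_congr_ae ?_
  filter_upwards [hN] with a ha
  simp_rw [hcount]
  rw [ENNReal.tsum_mul_right]
  congr 1
  have hfin : (U ∩ f ⁻¹' {a}).Finite := finite_of_encard_eq_coe ha
  rw [← measure_iUnion, ← iUnion_inter, hEU, Measure.count_apply_finite' hfin hfin.measurableSet]
  · rw [hfin.encard_eq_coe_toFinset_card] at ha
    exact_mod_cast ha
  · exact fun i j hij => (hEd hij).mono inter_subset_left inter_subset_left
  · intro n
    refine (hfin.subset ?_).measurableSet
    rintro x ⟨hx, hxa⟩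
    exact ⟨hx.1, hxa⟩

/-- If the Wronskian vanished, coprimality would force P to divide P', hence P' = 0 by degree. Its
roots, the critical points of P / Q, are therefore finite in number. -/
lemma wronskian_ne_zero {P Q : ℂ[X]} (hP : 0 < P.natDegree) (hPQ : IsCoprime P Q) :
    derivative P * Q - P * derivative Q ≠ 0 := by
  intro h
  have h1 : P ∣ derivative P * Q := ⟨derivative Q, sub_eq_zero.1 h⟩
  have h2 : P ∣ derivative P := hPQ.dvd_of_dvd_mul_right h1
  have h3 : derivative P = 0 := by
    refine eq_zero_of_dvd_of_natDegree_lt h2 (natDegree_derivative_lt hP.ne')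
  exact hP.ne' (derivative_eq_zero.1 h3)

lemma degree_C_mul_lt {P Q : ℂ[X]} (hdeg : Q.degree < P.degree) (a : ℂ) :
    (C a * Q).degree < P.degree := by
  rcases eq_or_ne a 0 with rfl | h
  · simpa using (bot_le.trans_lt hdeg)
  · rwa [degree_C_mul h]

lemma eval_ne_zero_of_isRoot_sub {P Q : ℂ[X]} (hPQ : IsCoprime P Q) {a x : ℂ}
    (hx : (P - C a * Q).IsRoot x) : Q.eval x ≠ 0 := by
  intro hq
  have hp : P.eval x = 0 := by simpa [IsRoot, hq] using hx
  obtain ⟨u, v, huv⟩ := hPQ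
  have := congrArg (eval x) huv
  simp [hp, hq] at this

/-- Away from the critical values of `P / Q`, the polynomial `P - a Q` has simple roots. -/
lemma nodup_roots_sub_C_mul {P Q : ℂ[X]} (hP : P.Monic) (hdeg : Q.degree < P.degree)
    (hPQ : IsCoprime P Q) {a : ℂ}
    (ha : ∀ x, (derivative P * Q - P * derivative Q).IsRoot x → P.eval x / Q.eval x ≠ a) :
    (P - C a * Q).roots.Nodup := by
  have hmonic : (P - C a * Q).Monic := hP.sub_of_left (degree_C_mul_lt hdeg a)
  rw [Multiset.nodup_iff_count_le_one]
  intro x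
  rw [count_roots]
  by_contra! hlt
  obtain ⟨hr, hr'⟩ := (one_lt_rootMultiplicity_iff_isRoot hmonic.ne_zero).1 hlt
  -- At a double root, P = aQ and P' = aQ', so the Wronskian vanishes and a is a critical value.
  have e1 : P.eval x = a * Q.eval x := by simpa [IsRoot, sub_eq_zero] using hr
  have e2 : (derivative P).eval x = a * (derivative Q).eval x := by
    simpa [IsRoot, sub_eq_zero] using hr'
  refine ha x ?_ ?_
  · simp only [IsRoot, eval_sub, eval_mul, e1, e2]
    ring
  · rw [div_eq_iff (eval_ne_zero_of_isRoot_sub hPQ hr), e1]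

/-- Generic fibres of the rational function `P / Q` have `deg P` points. -/
lemma encard_fibre_of_coprime {P Q : ℂ[X]} (hP : P.Monic) (hdeg : Q.degree < P.degree)
    (hPQ : IsCoprime P Q) {a : ℂ}
    (ha : ∀ x, (derivative P * Q - P * derivative Q).IsRoot x → P.eval x / Q.eval x ≠ a) :
    ({x | Q.eval x ≠ 0 ∧ (derivative P * Q - P * derivative Q).eval x ≠ 0} ∩
      (fun x => P.eval x / Q.eval x) ⁻¹' {a}).encard = P.natDegree := by
  have hdeg' := degree_C_mul_lt hdeg a
  have hmonic : (P - C a * Q).Monic := hP.sub_of_left hdeg'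
  have hQ : ∀ x, (P - C a * Q).IsRoot x → Q.eval x ≠ 0 :=
    fun x hx => eval_ne_zero_of_isRoot_sub hPQ hx
  have hdiv : ∀ x, (P - C a * Q).IsRoot x → P.eval x / Q.eval x = a := by
    intro x hx
    have h0 : P.eval x - a * Q.eval x = 0 := by simpa [IsRoot] using hx
    rw [div_eq_iff (hQ x hx)]
    exact sub_eq_zero.1 h0
  have hset : ({x | Q.eval x ≠ 0 ∧ (derivative P * Q - P * derivative Q).eval x ≠ 0} ∩
      (fun x => P.eval x / Q.eval x) ⁻¹' {a}) = ((P - C a * Q).roots.toFinset : Set ℂ) := by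
    ext x
    simp only [mem_inter_iff, mem_ofPred_eq, mem_preimage, mem_singleton_iff, Finset.mem_coe,
      Multiset.mem_toFinset, mem_roots hmonic.ne_zero]
    constructor
    · rintro ⟨⟨hq, -⟩, h⟩
      rw [div_eq_iff hq] at h
      simp [IsRoot, h]
    · intro h
      exact ⟨⟨hQ x h, fun hw => ha x hw (hdiv x h)⟩, hdiv x h⟩
  rw [hset, encard_coe_eq_coe_finsetCard, Multiset.toFinset_card_of_nodup
    (nodup_roots_sub_C_mul hP hdeg hPQ ha),
    IsAlgClosed.card_roots_eq_natDegree]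
  congr 1
  exact natDegree_eq_of_degree_eq (degree_sub_eq_left_of_degree_lt hdeg')

lemma ae_nodup_roots_sub_C_mul {P Q : ℂ[X]} (hP : P.Monic) (hdeg : Q.degree < P.degree)
    (hpos : 0 < P.natDegree) (hPQ : IsCoprime P Q) :
    ∀ᵐ a : ℂ, (P - C a * Q).roots.Nodup := by
  have hbad : ((fun x => P.eval x / Q.eval x) ''
      {x | (derivative P * Q - P * derivative Q).IsRoot x}).Finite :=
    (finite_setOfPred_isRoot (wronskian_ne_zero hpos hPQ)).image _
  filter_upwards [compl_mem_ae_iff.2 (hbad.measure_zero volume)] with a ha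
  exact nodup_roots_sub_C_mul hP hdeg hPQ fun x hx hxa => ha ⟨x, hx, hxa⟩

/-- Area formula for the rational function `P / Q`. -/
theorem lintegral_comp_div_mul_deriv_sq {P Q : ℂ[X]} (hP : P.Monic) (hdeg : Q.degree < P.degree)
    (hpos : 0 < P.natDegree) (hQ0 : Q ≠ 0) (hPQ : IsCoprime P Q) (h : ℂ → ℝ≥0∞)
    (hh : Measurable h) :
    ∫⁻ x, ENNReal.ofReal (‖(derivative P * Q - P * derivative Q).eval x / Q.eval x ^ 2‖ ^ 2) *
      h (P.eval x / Q.eval x) = P.natDegree * ∫⁻ a, h a := by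
  have hW := wronskian_ne_zero hpos hPQ
  set W := derivative P * Q - P * derivative Q with hWdef
  set U : Set ℂ := {x | Q.eval x ≠ 0 ∧ W.eval x ≠ 0} with hU
  have hUc : Uᶜ ⊆ {x | Q.IsRoot x} ∪ {x | W.IsRoot x} := by
    intro x hx
    simp only [hU, mem_compl_iff, mem_ofPred_eq, not_and_or, not_not] at hx
    exact hx
  have hfin : (Uᶜ).Finite :=
    ((finite_setOfPred_isRoot hQ0).union (finite_setOfPred_isRoot hW)).subset hUc
  have hUm : MeasurableSet U := by simpa using hfin.measurableSet.compl
  have hres : (volume : Measure ℂ).restrict U = volume := by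
    refine Measure.restrict_eq_self_of_ae_mem ?_
    have : Uᶜᶜ ∈ ae volume := compl_mem_ae_iff.2 (hfin.measure_zero volume)
    rwa [compl_compl] at this
  rw [← setLIntegral_comp_mul_deriv_sq (f := fun x => P.eval x / Q.eval x)
    (f' := fun x => W.eval x / Q.eval x ^ 2) hUm ?_ ?_ ?_ h hh, hres]
  · intro x hx
    have := (P.hasStrictDerivAt x).div (Q.hasStrictDerivAt x) hx.1
    convert! this using 1
    simp [hWdef]
  · intro x hx
    exact div_ne_zero hx.2 (pow_ne_zero 2 hx.1)
  · have hbad : ((fun x => P.eval x / Q.eval x) '' {x | W.IsRoot x}).Finite :=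
      (finite_setOfPred_isRoot hW).image _
    filter_upwards [compl_mem_ae_iff.2 (hbad.measure_zero volume)] with a ha
    refine encard_fibre_of_coprime hP hdeg hPQ fun x hx hxa => ha ⟨x, hx, hxa⟩

/-- The case P = X^d, Q = 1 of the area formula, phrased as a push-forward of measures so that it
also applies to Bochner integrals of complex functions. -/
theorem map_pow_withDensity {d : ℕ} (hd : 1 ≤ d) :
    Measure.map (fun x : ℂ => x ^ d)
      (volume.withDensity fun x => ENNReal.ofReal (‖(d : ℂ) * x ^ (d - 1)‖ ^ 2)) =
      (d : ℝ≥0∞) • volume := by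
  ext s hs
  have hm : Measurable fun x : ℂ => x ^ d := by fun_prop
  have key := lintegral_comp_div_mul_deriv_sq (P := X ^ d) (Q := 1) (monic_X_pow d)
    (by rw [degree_one, degree_X_pow]; exact_mod_cast hd)
    (by simpa using Nat.pos_of_ne_zero (by omega)) one_ne_zero
    isCoprime_one_right (s.indicator 1) (measurable_one.indicator hs)
  simp only [natDegree_X_pow, lintegral_indicator_one hs] at key
  rw [Measure.map_apply hm hs, withDensity_apply _ (hm hs), Measure.smul_apply, smul_eq_mul, ← key,
    ← lintegral_indicator (hm hs)]
  refine lintegral_congr fun x => ?_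
  by_cases hx : x ^ d ∈ s <;> simp [hx, derivative_X_pow, -ofReal_norm]

theorem integral_comp_pow {d : ℕ} (hd : 1 ≤ d) {g : ℂ → ℂ} (hg : Measurable g) :
    ∫ x : ℂ, ((‖(d : ℂ) * x ^ (d - 1)‖ ^ 2 : ℝ) : ℂ) * g (x ^ d) = d * ∫ w, g w := by
  have hm : Measurable fun x : ℂ => x ^ d := by fun_prop
  have h := congrArg (fun μ => ∫ w, g w ∂μ) (map_pow_withDensity hd)
  simp only [integral_smul_measure, ENNReal.toReal_natCast] at h
  rw [integral_map hm.aemeasurable hg.aestronglyMeasurable,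
    integral_withDensity_eq_integral_toReal_smul (by fun_prop) (by simp)] at h
  simpa [ENNReal.toReal_ofReal, sq_nonneg] using h

end AreaFormula

/-! ### Andréief's identity. -/

section Andreief

open scoped ComplexConjugate

lemma det_eq_sum_prod_apply {n : ℕ} (M : Matrix (Fin n) (Fin n) ℂ) :
    M.det = ∑ σ : Equiv.Perm (Fin n), (Equiv.Perm.sign σ : ℂ) * ∏ i, M i (σ i) := by
  rw [← Matrix.det_transpose, Matrix.det_apply']
  rfl

/-- The squared modulus of the Vandermonde determinant as a double sum over permutations. -/
lemma prod_norm_sub_sq_eq_sum {n : ℕ} (z : Fin n → ℂ) :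
    ((∏ i, ∏ j ∈ Finset.Ioi i, ‖z j - z i‖ ^ 2 : ℝ) : ℂ) =
      ∑ σ : Equiv.Perm (Fin n), ∑ τ : Equiv.Perm (Fin n),
        ((Equiv.Perm.sign σ : ℂ) * (Equiv.Perm.sign τ : ℂ)) *
          ∏ i, (z i ^ (σ i : ℕ) * conj (z i) ^ (τ i : ℕ)) := by
  have h1 : ∀ v : Fin n → ℂ, ∏ i, ∏ j ∈ Finset.Ioi i, (v j - v i) =
      ∑ σ : Equiv.Perm (Fin n), (Equiv.Perm.sign σ : ℂ) * ∏ i, v i ^ (σ i : ℕ) := by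
    intro v
    rw [← Matrix.det_vandermonde, det_eq_sum_prod_apply]
    rfl
  have h2 : ((∏ i, ∏ j ∈ Finset.Ioi i, ‖z j - z i‖ ^ 2 : ℝ) : ℂ) =
      (∏ i, ∏ j ∈ Finset.Ioi i, (z j - z i)) *
        ∏ i, ∏ j ∈ Finset.Ioi i, (conj (z j) - conj (z i)) := by
    push_cast
    simp_rw [← Finset.prod_mul_distrib]
    refine Finset.prod_congr rfl fun i _ => Finset.prod_congr rfl fun j _ => ?_
    rw [← map_sub, Complex.mul_conj, Complex.normSq_eq_norm_sq]
    push_cast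
    rfl
  rw [h2, h1, h1 fun i => conj (z i), Finset.sum_mul_sum]
  refine Finset.sum_congr rfl fun σ _ => Finset.sum_congr rfl fun τ _ => ?_
  rw [Finset.prod_mul_distrib]
  ring

lemma andreief_integrand {n : ℕ} (w : ℂ → ℝ) (z : Fin n → ℂ) :
    (((∏ j, w (z j)) * ∏ i, ∏ j ∈ Finset.Ioi i, ‖z j - z i‖ ^ 2 : ℝ) : ℂ) =
      ∑ σ : Equiv.Perm (Fin n), ∑ τ : Equiv.Perm (Fin n),
        ((Equiv.Perm.sign σ : ℂ) * (Equiv.Perm.sign τ : ℂ)) *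
          ∏ i, (z i ^ (σ i : ℕ) * conj (z i) ^ (τ i : ℕ) * (w (z i) : ℂ)) := by
  rw [Complex.ofReal_mul, prod_norm_sub_sq_eq_sum, Finset.mul_sum]
  refine Finset.sum_congr rfl fun σ _ => ?_
  rw [Finset.mul_sum]
  refine Finset.sum_congr rfl fun τ _ => ?_
  rw [Finset.prod_mul_distrib (g := fun i => (w (z i) : ℂ)), Complex.ofReal_prod]
  ring

variable {n : ℕ} {w : ℂ → ℝ}

lemma integrable_andreief_term
    (hw : ∀ a b : Fin n, Integrable fun z : ℂ => z ^ (a : ℕ) * conj z ^ (b : ℕ) * (w z : ℂ))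
    (σ τ : Equiv.Perm (Fin n)) :
    Integrable fun z : Fin n → ℂ => ((Equiv.Perm.sign σ : ℂ) * (Equiv.Perm.sign τ : ℂ)) *
      ∏ i, (z i ^ (σ i : ℕ) * conj (z i) ^ (τ i : ℕ) * (w (z i) : ℂ)) := by
  refine Integrable.const_mul ?_ _
  exact Integrable.fintype_prod (f := fun i (z : ℂ) =>
    z ^ (σ i : ℕ) * conj z ^ (τ i : ℕ) * (w z : ℂ)) fun i => hw (σ i) (τ i)

theorem integrable_prod_mul_vandermonde_sq
    (hw : ∀ a b : Fin n, Integrable fun z : ℂ => z ^ (a : ℕ) * conj z ^ (b : ℕ) * (w z : ℂ)) :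
    Integrable fun z : Fin n → ℂ =>
      (∏ j, w (z j)) * ∏ i, ∏ j ∈ Finset.Ioi i, ‖z j - z i‖ ^ 2 := by
  have h : Integrable fun z : Fin n → ℂ =>
      (((∏ j, w (z j)) * ∏ i, ∏ j ∈ Finset.Ioi i, ‖z j - z i‖ ^ 2 : ℝ) : ℂ) := by
    simp_rw [andreief_integrand]
    exact integrable_finsetSum _ fun σ _ => integrable_finsetSum _ fun τ _ =>
      integrable_andreief_term hw σ τ
  exact h.re.congr (ae_of_all _ fun z => Complex.ofReal_re _)

/-- Andréief's identity for the squared modulus of the Vandermonde determinant. -/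
theorem integral_prod_mul_vandermonde_sq
    (hw : ∀ a b : Fin n, Integrable fun z : ℂ => z ^ (a : ℕ) * conj z ^ (b : ℕ) * (w z : ℂ)) :
    ((∫ z : Fin n → ℂ, (∏ j, w (z j)) * ∏ i, ∏ j ∈ Finset.Ioi i, ‖z j - z i‖ ^ 2 : ℝ) : ℂ) =
      n.factorial * (Matrix.of fun a b : Fin n =>
        ∫ z : ℂ, z ^ (a : ℕ) * conj z ^ (b : ℕ) * (w z : ℂ)).det := by
  set M : Matrix (Fin n) (Fin n) ℂ := Matrix.of fun a b : Fin n =>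
        ∫ z : ℂ, z ^ (a : ℕ) * conj z ^ (b : ℕ) * (w z : ℂ) with hM
  rw [← integral_complex_ofReal]
  simp_rw [andreief_integrand]
  rw [integral_finsetSum _ fun σ _ => integrable_finsetSum _ fun τ _ =>
      integrable_andreief_term hw σ τ]
  -- For fixed σ the sum over τ is the determinant of the moment matrix with rows permuted by σ, and
  -- the second sign cancels the permutation. The n! values of σ contribute equally.
  have hσ : ∀ σ : Equiv.Perm (Fin n), ∫ z : Fin n → ℂ, ∑ τ : Equiv.Perm (Fin n),
      ((Equiv.Perm.sign σ : ℂ) * (Equiv.Perm.sign τ : ℂ)) *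
      ∏ i, (z i ^ (σ i : ℕ) * conj (z i) ^ (τ i : ℕ) * (w (z i) : ℂ)) = M.det := by
    intro σ
    rw [integral_finsetSum _ fun τ _ => integrable_andreief_term hw σ τ]
    have hτ : ∀ τ : Equiv.Perm (Fin n), ∫ z : Fin n → ℂ,
        ((Equiv.Perm.sign σ : ℂ) * (Equiv.Perm.sign τ : ℂ)) *
        ∏ i, (z i ^ (σ i : ℕ) * conj (z i) ^ (τ i : ℕ) * (w (z i) : ℂ)) =
        (Equiv.Perm.sign σ : ℂ) * ((Equiv.Perm.sign τ : ℂ) * ∏ i, M.submatrix σ id i (τ i)) := by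
      intro τ
      rw [integral_const_mul, integral_fintype_prod_volume_eq_prod (fun i (z : ℂ) =>
        z ^ (σ i : ℕ) * conj z ^ (τ i : ℕ) * (w z : ℂ)), mul_assoc]
      rfl
    simp_rw [hτ]
    rw [← Finset.mul_sum, ← det_eq_sum_prod_apply, Matrix.det_permute, ← mul_assoc]
    rcases Int.units_eq_one_or (Equiv.Perm.sign σ) with h | h <;> simp [h]
  simp_rw [hσ]
  simp [Fintype.card_perm]

end Andreief

/-! ### Planar moments and the Ginibre partition function. -/

section Moments

open scoped ComplexConjugate

/-- The integral has a positive closed form, whereas the integral of a non-integrable function is 0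
by convention. -/
lemma integrable_norm_rpow_mul_exp {p q b : ℝ} (hp : 1 ≤ p) (hq : -2 < q) (hb : 0 < b) :
    Integrable fun z : ℂ => ‖z‖ ^ q * Real.exp (-b * ‖z‖ ^ p) := by
  by_contra h
  have h1 := Complex.integral_rpow_mul_exp_neg_mul_rpow hp hq hb
  rw [integral_undef h] at h1
  have h2 : 0 < Real.Gamma ((q + 2) / p) := Real.Gamma_pos_of_pos (by apply div_pos <;> linarith)
  have h3 : 0 < (2 * Real.pi / p) * b ^ (-(q + 2) / p) := by positivity
  exact (mul_pos h3 h2).ne h1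

/-- Polynomial moments of a weight dominated by `‖z‖ ^ γ * exp (-b ‖z‖ ^ p)` converge. -/
lemma integrable_monomial_mul {w : ℂ → ℝ} (hw : Measurable w) {C γ b p : ℝ} (hp : 1 ≤ p)
    (hγ : -2 < γ) (hb : 0 < b) (hle : ∀ z, |w z| ≤ C * (‖z‖ ^ γ * Real.exp (-b * ‖z‖ ^ p)))
    (j k : ℕ) : Integrable fun z : ℂ => z ^ j * conj z ^ k * (w z : ℂ) := by
  have hq : -2 < ((j + k : ℕ) : ℝ) + γ := by
    have : (0 : ℝ) ≤ ((j + k : ℕ) : ℝ) := Nat.cast_nonneg _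
    linarith
  refine Integrable.mono' ((integrable_norm_rpow_mul_exp hp hq hb).const_mul C) ?_ ?_
  · have : Measurable fun z : ℂ => z ^ j * conj z ^ k * (w z : ℂ) := by fun_prop
    exact this.aestronglyMeasurable
  · have h0 : ∀ᵐ z : ℂ, z ≠ 0 := by simp [ae_iff]
    filter_upwards [h0] with z hz
    have hz' : 0 < ‖z‖ := norm_pos_iff.2 hz
    rw [Real.rpow_add hz', Real.rpow_natCast]
    simp only [norm_mul, norm_pow, RCLike.norm_conj, Complex.norm_real, Real.norm_eq_abs]
    rw [← pow_add]
    calc ‖z‖ ^ (j + k) * |w z|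
        ≤ ‖z‖ ^ (j + k) * (C * (‖z‖ ^ γ * Real.exp (-b * ‖z‖ ^ p))) := by
          gcongr; exact hle z
      _ = _ := by ring

/-- Rotating by ω preserves Lebesgue measure and the weight, and multiplies the integral by ω^j
conj(ω)^k = ω^(j - k), which is not 1. -/
lemma integral_monomial_mul_eq_zero_of_rotation {w : ℂ → ℝ} {ω : ℂ} (hω : ‖ω‖ = 1)
    (hw : ∀ z, w (ω * z) = w z) {j k : ℕ} (hjk : ω ^ j ≠ ω ^ k) :
    ∫ z : ℂ, z ^ j * conj z ^ k * (w z : ℂ) = 0 := by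
  set I := ∫ z : ℂ, z ^ j * conj z ^ k * (w z : ℂ) with hI
  let u : Circle := ⟨ω, by simpa [Submonoid.unitSphere] using hω⟩
  have hrot : I = ∫ z : ℂ, (ω * z) ^ j * conj (ω * z) ^ k * (w (ω * z) : ℂ) :=
    ((rotation u).measurePreserving.integral_comp
      (rotation u).toHomeomorph.measurableEmbedding
      (fun z : ℂ => z ^ j * conj z ^ k * (w z : ℂ))).symm
  have h2 : I = ω ^ j * conj ω ^ k * I := by
    conv_lhs => rw [hrot]
    rw [hI, ← integral_const_mul]
    refine integral_congr_ae (ae_of_all _ fun z => ?_)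
    simp only [hw, map_mul, mul_pow]
    ring
  have h3 : ω ^ k * conj ω ^ k = 1 := by
    rw [← mul_pow, Complex.mul_conj, Complex.normSq_eq_norm_sq, hω]
    simp
  by_contra hne
  have h4 : ω ^ j * conj ω ^ k = 1 := by
    have : (ω ^ j * conj ω ^ k - 1) * I = 0 := by rw [sub_mul, one_mul, ← h2, sub_self]
    exact sub_eq_zero.1 ((mul_eq_zero.1 this).resolve_right hne)
  have h5 : conj ω ^ k ≠ 0 := by
    intro h; rw [h, mul_zero] at h3; exact zero_ne_one h3
  exact hjk (mul_right_cancel₀ h5 (h4.trans h3.symm))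

lemma integral_monomial_mul_eq_zero {w : ℂ → ℝ} {m : ℕ} (hm : m ≠ 0)
    (hw : ∀ ω z : ℂ, ω ^ m = 1 → w (ω * z) = w z) {j k : ℕ} (hjk : j % m ≠ k % m) :
    ∫ z : ℂ, z ^ j * conj z ^ k * (w z : ℂ) = 0 := by
  have hprim := Complex.isPrimitiveRoot_exp m hm
  refine integral_monomial_mul_eq_zero_of_rotation
    (Complex.norm_eq_one_of_pow_eq_one hprim.pow_eq_one hm)
    (fun z => hw _ z hprim.pow_eq_one) fun h => hjk ?_
  rw [← pow_mod_orderOf _ j, ← pow_mod_orderOf _ k, ← hprim.eq_orderOf] at h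
  exact hprim.pow_inj (Nat.mod_lt _ (Nat.pos_of_ne_zero hm))
    (Nat.mod_lt _ (Nat.pos_of_ne_zero hm)) h

lemma exp_ginibre_le (s : ℝ) (z : ℂ) :
    |Real.exp (-s * ginibrePotential z)| ≤
      1 * (‖z‖ ^ (0 : ℝ) * Real.exp (-s * ‖z‖ ^ (2 : ℝ))) := by
  rw [abs_of_pos (Real.exp_pos _)]
  simp [ginibrePotential]

lemma measurable_ginibre (s : ℝ) : Measurable fun z => Real.exp (-s * ginibrePotential z) := by
  unfold ginibrePotential
  fun_prop

lemma integrable_ginibre_moment {s : ℝ} (hs : 0 < s) (j k : ℕ) :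
    Integrable fun z : ℂ => z ^ j * conj z ^ k * (Real.exp (-s * ginibrePotential z) : ℂ) :=
  integrable_monomial_mul (measurable_ginibre s) (by norm_num) (by norm_num) hs
    (exp_ginibre_le s) j k

lemma integral_ginibre_moment {s : ℝ} (hs : 0 < s) (j k : ℕ) :
    ∫ z : ℂ, z ^ j * conj z ^ k * (Real.exp (-s * ginibrePotential z) : ℂ) =
      if j = k then ((Real.pi * j.factorial / s ^ (j + 1) : ℝ) : ℂ) else 0 := by
  split_ifs with h
  · subst h
    have h1 := Complex.integral_rpow_mul_exp_neg_mul_rpow (p := 2) (q := 2 * j) (b := s)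
      (by norm_num) (by have : (0 : ℝ) ≤ j := Nat.cast_nonneg j
                        linarith) hs
    have h2 : ∀ z : ℂ, z ^ j * conj z ^ j * (Real.exp (-s * ginibrePotential z) : ℂ) =
        ((‖z‖ ^ (2 * j : ℝ) * Real.exp (-s * ‖z‖ ^ (2 : ℝ)) : ℝ) : ℂ) := by
      intro z
      rw [← mul_pow, Complex.mul_conj, Complex.normSq_eq_norm_sq, ginibrePotential,
        Real.rpow_mul (norm_nonneg z)]
      push_cast
      simp
    simp_rw [h2]
    rw [integral_complex_ofReal, h1]
    congr 1
    have e1 : ((2 * j : ℝ) + 2) / 2 = j + 1 := by ring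
    have e2 : (-((2 * j : ℝ) + 2)) / 2 = -((j + 1 : ℕ) : ℝ) := by push_cast; ring
    rw [e1, e2, Real.Gamma_nat_eq_factorial, Real.rpow_neg hs.le, Real.rpow_natCast]
    field_simp
  -- The weight is invariant under all rotations; a modulus exceeding both exponents makes distinct
  -- exponents incongruent.
  · refine integral_monomial_mul_eq_zero (m := j + k + 1) (by omega) ?_ ?_
    · intro ω z hω
      have := Complex.norm_eq_one_of_pow_eq_one hω (by omega)
      simp [ginibrePotential, this]
    · rwa [Nat.mod_eq_of_lt (by omega), Nat.mod_eq_of_lt (by omega)]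

lemma weight_ginibre_integrable {N : ℕ} (hN : 1 ≤ N) : Integrable (weight N ginibrePotential) :=
  integrable_prod_mul_vandermonde_sq fun a b =>
    integrable_ginibre_moment (s := N) (by exact_mod_cast hN) a b

lemma sum_fin_val_real (N : ℕ) : ∑ k ∈ Finset.range N, (k : ℝ) = N * (N - 1) / 2 := by
  induction N with
  | zero => simp
  | succ n ih => rw [Finset.sum_range_succ, ih]; push_cast; ring

/-- Rotation invariance makes the moment matrix diagonal with entries π a! / N^(a+1). The prefactor
N! of Andréief's identity shifts the product of the a! from a < N to 1 ≤ a ≤ N. -/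
theorem partitionFunction_ginibre {N : ℕ} (hN : 1 ≤ N) :
    partitionFunction N ginibrePotential =
      Real.pi ^ N * (∏ k ∈ Finset.Icc 1 N, (k.factorial : ℝ)) /
        (N : ℝ) ^ ((N : ℝ) * (N + 1) / 2) := by
  have hs : (0 : ℝ) < N := by exact_mod_cast hN
  have h := integral_prod_mul_vandermonde_sq (n := N)
    fun a b => integrable_ginibre_moment hs a b
  have hM : (Matrix.of fun a b : Fin N => ∫ z : ℂ, z ^ (a : ℕ) * conj z ^ (b : ℕ) *
      (Real.exp (-(N : ℝ) * ginibrePotential z) : ℂ)) = Matrix.diagonal fun a : Fin N =>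
        ((Real.pi * (a : ℕ).factorial / (N : ℝ) ^ ((a : ℕ) + 1) : ℝ) : ℂ) := by
    ext a b
    rw [Matrix.of_apply, integral_ginibre_moment hs, Matrix.diagonal_apply]
    simp only [Fin.ext_iff]
  rw [hM, Matrix.det_diagonal, ← Complex.ofReal_prod, ← Complex.ofReal_natCast,
    ← Complex.ofReal_mul] at h
  have h' := Complex.ofReal_injective h
  change partitionFunction N ginibrePotential = _ at h'
  rw [h', Fin.prod_univ_eq_prod_range
    (fun a => Real.pi * (a.factorial : ℝ) / (N : ℝ) ^ (a + 1)) N, Finset.prod_div_distrib,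
    Finset.prod_mul_distrib, Finset.prod_const, Finset.card_range]
  have e1 : ∏ k ∈ Finset.Icc 1 N, (k.factorial : ℝ) =
      N.factorial * ∏ k ∈ Finset.range N, (k.factorial : ℝ) := by
    have : ∀ n : ℕ, ∏ k ∈ Finset.Icc 1 n, (k.factorial : ℝ) =
        n.factorial * ∏ k ∈ Finset.range n, (k.factorial : ℝ) := by
      intro n
      induction n with
      | zero => simp
      | succ n ih =>
        rw [Finset.prod_Icc_succ_top (by omega), ih, Finset.prod_range_succ]
        ring
    exact this N
  have e2 : ∏ k ∈ Finset.range N, (N : ℝ) ^ (k + 1) = (N : ℝ) ^ ((N : ℝ) * (N + 1) / 2) := by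
    rw [Finset.prod_pow_eq_pow_sum, ← Real.rpow_natCast]
    congr 1
    push_cast
    rw [Finset.sum_add_distrib, sum_fin_val_real]
    simp
    ring
  rw [e1, e2]
  ring

end Moments

/-! ### Reduction of the lemniscate ensemble to d Ginibre-type integrals. -/

section Reduction

open scoped ComplexConjugate

/-- Completing the square shows that the potential depends on z only through z^d, the source of the
ℤ/d symmetry. -/
lemma lemniscatePotential_eq (d : ℕ) (t : ℝ) (z : ℂ) :
    lemniscatePotential d t z = ‖z ^ d - t‖ ^ 2 - t ^ 2 := by
  rw [lemniscatePotential, ← Complex.normSq_eq_norm_sq, Complex.normSq_sub, pow_mul',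
    ← norm_pow, ← Complex.normSq_eq_norm_sq, ← map_pow]
  have h : (conj z ^ d).re = (z ^ d).re := by rw [← map_pow, Complex.conj_re]
  simp [h]
  ring

/-- The weight `‖u‖ ^ γ * exp (-s ‖u - t‖ ^ 2)`. -/
noncomputable def shiftedWeight (γ s t : ℝ) (u : ℂ) : ℝ := ‖u‖ ^ γ * Real.exp (-s * ‖u - t‖ ^ 2)

lemma measurable_shiftedWeight (γ s t : ℝ) : Measurable (shiftedWeight γ s t) := by
  unfold shiftedWeight
  fun_prop

/-- From (a + b)² ≤ 2a² + 2b². It dominates the shifted Gaussian by a centred one, so the general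
moment criterion applies. -/
lemma half_norm_sq_sub_le (u : ℂ) (t : ℝ) : ‖u‖ ^ 2 / 2 - t ^ 2 ≤ ‖u - t‖ ^ 2 := by
  have h : ‖u‖ ≤ ‖u - t‖ + |t| := by
    have := norm_add_le (u - t) (t : ℂ)
    simpa using this
  have h2 : ‖u‖ ^ 2 ≤ (‖u - t‖ + |t|) ^ 2 := by gcongr
  nlinarith [sq_nonneg (‖u - t‖ - |t|), sq_abs t]

lemma integrable_shiftedWeight_moment {γ s : ℝ} (hγ : -2 < γ) (hs : 0 < s) (t : ℝ) (j k : ℕ) :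
    Integrable fun u : ℂ => u ^ j * conj u ^ k * (shiftedWeight γ s t u : ℂ) := by
  refine integrable_monomial_mul (measurable_shiftedWeight γ s t) (C := Real.exp (s * t ^ 2))
    (γ := γ) (b := s / 2) (p := 2) (by norm_num) hγ (by positivity) (fun u => ?_) j k
  have h0 : 0 ≤ ‖u‖ ^ γ := by positivity
  rw [shiftedWeight, abs_of_nonneg (by positivity), mul_left_comm, ← Real.exp_add]
  gcongr
  rw [Real.rpow_two]
  nlinarith [half_norm_sq_sub_le u t]

lemma integrable_lemniscate_moment {s : ℝ} (hs : 0 < s) {d : ℕ} (hd : 1 ≤ d) (t : ℝ) (j k : ℕ) :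
    Integrable fun z : ℂ =>
      z ^ j * conj z ^ k * (Real.exp (-s * lemniscatePotential d t z) : ℂ) := by
  simp_rw [lemniscatePotential_eq]
  have hd' : (1 : ℝ) ≤ d := by exact_mod_cast hd
  refine integrable_monomial_mul (w := fun z => Real.exp (-s * (‖z ^ d - t‖ ^ 2 - t ^ 2)))
    (by fun_prop) (C := Real.exp (s * (2 * t ^ 2)))
    (γ := 0) (b := s / 2) (p := 2 * d) (by linarith) (by norm_num) (by positivity)
    (fun u => ?_) j k
  rw [abs_of_pos (Real.exp_pos _), Real.rpow_zero, one_mul, ← Real.exp_add]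
  gcongr
  have e : ‖u‖ ^ (2 * d : ℝ) = ‖u ^ d‖ ^ 2 := by
    rw [norm_pow, ← pow_mul, ← Real.rpow_natCast]
    congr 1
    push_cast
    ring
  rw [e]
  nlinarith [half_norm_sq_sub_le (u ^ d) t]

lemma gammaExponent_gt {d ℓ : ℕ} (hd : 1 ≤ d) : -2 < gammaExponent d ℓ := by
  have : 0 < ((ℓ : ℝ) + 1) / d := by positivity
  unfold gammaExponent
  linarith

/-- Substitute u = z^d, a d-to-one map with Jacobian d²|z|^(2(d-1)). The exponent γ_ℓ solves 2(d -
1) + dγ = 2ℓ, so |u|^γ times the Jacobian leaves exactly the surplus factor |z|^(2ℓ) = z^ℓ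
conj(z)^ℓ. The factor exp(st²) comes from the completed square. -/
lemma lemniscate_moment_diag (s : ℝ) {d : ℕ} (hd : 1 ≤ d) (t : ℝ) (ℓ a b : ℕ) :
    ∫ z : ℂ, z ^ (ℓ + d * a) * conj z ^ (ℓ + d * b) *
        (Real.exp (-s * lemniscatePotential d t z) : ℂ) =
      ((Real.exp (s * t ^ 2) / d : ℝ) : ℂ) * ∫ u : ℂ, u ^ a * conj u ^ b *
        (shiftedWeight (gammaExponent d ℓ) s t u : ℂ) := by
  have hd0 : (d : ℝ) ≠ 0 := by positivity
  have hdC : (d : ℂ) ≠ 0 := by exact_mod_cast hd0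
  have h := integral_comp_pow hd (g := fun u : ℂ => u ^ a * conj u ^ b *
        (shiftedWeight (gammaExponent d ℓ) s t u : ℂ))
        (by have := measurable_shiftedWeight (gammaExponent d ℓ) s t
            fun_prop)
  have h0 : ∀ᵐ z : ℂ, z ≠ 0 := by simp [ae_iff]
  have hcongr : ∫ z : ℂ, ((‖(d : ℂ) * z ^ (d - 1)‖ ^ 2 : ℝ) : ℂ) * ((z ^ d) ^ a * conj (z ^ d) ^ b *
        (shiftedWeight (gammaExponent d ℓ) s t (z ^ d) : ℂ)) =
      ∫ z : ℂ, ((d ^ 2 * Real.exp (-(s * t ^ 2)) : ℝ) : ℂ) *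
        (z ^ (ℓ + d * a) * conj z ^ (ℓ + d * b) *
        (Real.exp (-s * lemniscatePotential d t z) : ℂ)) := by
    refine integral_congr_ae ?_
    filter_upwards [h0] with z hz
    have hz' : 0 < ‖z‖ := norm_pos_iff.2 hz
    have e1 : (‖z‖ ^ (d - 1)) ^ 2 * ‖z ^ d‖ ^ (gammaExponent d ℓ) = (‖z‖ ^ 2) ^ ℓ := by
      rw [norm_pow, ← Real.rpow_natCast _ d, ← Real.rpow_mul hz'.le, ← pow_mul, ← pow_mul,
        ← Real.rpow_natCast, ← Real.rpow_natCast, ← Real.rpow_add hz', gammaExponent]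
      congr 1
      push_cast [Nat.cast_sub hd]
      field_simp
      ring
    have e2 : z ^ ℓ * conj z ^ ℓ = (((‖z‖ ^ 2) ^ ℓ : ℝ) : ℂ) := by
      rw [← mul_pow, Complex.mul_conj, Complex.normSq_eq_norm_sq]
      push_cast
      rfl
    have e3 : Real.exp (-s * lemniscatePotential d t z) =
        Real.exp (s * t ^ 2) * Real.exp (-s * ‖z ^ d - t‖ ^ 2) := by
      rw [lemniscatePotential_eq, ← Real.exp_add]
      congr 1
      ring
    have e4 : Real.exp (-(s * t ^ 2)) * Real.exp (s * t ^ 2) = 1 := by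
      rw [← Real.exp_add]; simp
    have e5 : (z ^ d) ^ a * conj (z ^ d) ^ b * (z ^ ℓ * conj z ^ ℓ) =
        z ^ (ℓ + d * a) * conj z ^ (ℓ + d * b) := by
      rw [map_pow]; ring
    have e6 : ‖(d : ℂ) * z ^ (d - 1)‖ ^ 2 * shiftedWeight (gammaExponent d ℓ) s t (z ^ d) =
        (d ^ 2 * Real.exp (-(s * t ^ 2))) * ((‖z‖ ^ 2) ^ ℓ *
          Real.exp (-s * lemniscatePotential d t z)) := by
      rw [shiftedWeight, e3, ← e1, norm_mul, norm_pow, Complex.norm_natCast]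
      linear_combination (-(d : ℝ) ^ 2 * (‖z‖ ^ (d - 1)) ^ 2 * ‖z ^ d‖ ^ (gammaExponent d ℓ) *
        Real.exp (-s * ‖z ^ d - t‖ ^ 2)) * e4
    have e7 := congrArg (fun x : ℝ => (x : ℂ)) e6
    simp only [Complex.ofReal_mul (_ * _) (_ * _), Complex.ofReal_mul (‖_‖ ^ 2) _,
      Complex.ofReal_mul ((‖_‖ ^ 2) ^ _) _] at e7
    rw [← e2] at e7
    rw [← e5]
    linear_combination ((z ^ d) ^ a * conj (z ^ d) ^ b) * e7
  rw [hcongr, integral_const_mul] at h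
  have e4 : ((Real.exp (s * t ^ 2) : ℝ) : ℂ) * ((Real.exp (-(s * t ^ 2)) : ℝ) : ℂ) = 1 := by
    rw [← Complex.ofReal_mul, ← Real.exp_add]; simp
  rw [Complex.ofReal_mul] at h
  rw [Complex.ofReal_div]
  simp only [Complex.ofReal_natCast, Complex.ofReal_pow] at h ⊢
  generalize (∫ z : ℂ, z ^ (ℓ + d * a) * conj z ^ (ℓ + d * b) *
        (Real.exp (-s * lemniscatePotential d t z) : ℂ)) = I at h ⊢
  field_simp
  refine mul_left_cancel₀ hdC ?_
  linear_combination ((Real.exp (s * t ^ 2) : ℝ) : ℂ) * h - d ^ 2 * I * e4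

lemma lemniscate_moment_offDiag (s : ℝ) {d : ℕ} (hd : 1 ≤ d) (t : ℝ) {j k : ℕ}
    (hjk : j % d ≠ k % d) : ∫ z : ℂ, z ^ j * conj z ^ k *
      (Real.exp (-s * lemniscatePotential d t z) : ℂ) = 0 := by
  refine integral_monomial_mul_eq_zero (w := fun z => Real.exp (-s * lemniscatePotential d t z))
    (by omega) (fun ω z hω => ?_) hjk
  simp only [lemniscatePotential_eq, mul_pow, hω, one_mul]

/-- The integral of `∏ⱼ ‖uⱼ‖ ^ γ exp (-s ‖uⱼ - t‖ ^ 2)` against the squared Vandermonde. -/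
noncomputable def shiftedPartition (N : ℕ) (γ s t : ℝ) : ℝ :=
  ∫ u : Fin N → ℂ, (∏ j, shiftedWeight γ s t (u j)) * ∏ i, ∏ j ∈ Finset.Ioi i, ‖u j - u i‖ ^ 2

lemma weight_lemniscate_integrable {N d : ℕ} (hN : 1 ≤ N) (hd : 1 ≤ d) (t : ℝ) :
    Integrable (weight (N * d) (lemniscatePotential d t)) :=
  integrable_prod_mul_vandermonde_sq fun a b =>
    integrable_lemniscate_moment (s := (N * d : ℕ)) (by positivity) hd t a b

/-- The `ℤ/d` symmetry splits the lemniscate partition function into `d` factors. -/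
theorem partitionFunction_lemniscate_eq_prod {N d : ℕ} (hN : 1 ≤ N) (hd : 1 ≤ d) (t : ℝ) :
    partitionFunction (N * d) (lemniscatePotential d t) =
      (N * d).factorial * ∏ ℓ ∈ Finset.range d,
        ((Real.exp (((N * d : ℕ) : ℝ) * t ^ 2) / d) ^ N *
          (shiftedPartition N (gammaExponent d ℓ) (N * d : ℕ) t / N.factorial)) := by
  set s : ℝ := ((N * d : ℕ) : ℝ) with hsdef
  have hs : 0 < s := by rw [hsdef]; positivity
  have h := integral_prod_mul_vandermonde_sq (n := N * d)
    fun a b => integrable_lemniscate_moment hs hd t a b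
  set μ : Fin d → Matrix (Fin N) (Fin N) ℂ := fun ℓ => Matrix.of fun a b : Fin N =>
    ∫ u : ℂ, u ^ (a : ℕ) * conj u ^ (b : ℕ) * (shiftedWeight (gammaExponent d ℓ) s t u : ℂ) with hμ
  have hM : (Matrix.of fun a b : Fin (N * d) => ∫ z : ℂ, z ^ (a : ℕ) * conj z ^ (b : ℕ) *
      (Real.exp (-s * lemniscatePotential d t z) : ℂ)) =
      (Matrix.blockDiagonal fun ℓ : Fin d => ((Real.exp (s * t ^ 2) / d : ℝ) : ℂ) • μ ℓ).submatrix
        finProdFinEquiv.symm finProdFinEquiv.symm := by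
    ext j k
    -- `finProdFinEquiv` sends (a, ℓ) to ℓ + d a, so the second component is the residue class that
    -- labels the block.
    obtain ⟨⟨a, ℓ⟩, rfl⟩ := finProdFinEquiv.surjective j
    obtain ⟨⟨b, ℓ'⟩, rfl⟩ := finProdFinEquiv.surjective k
    rw [Matrix.submatrix_apply, Equiv.symm_apply_apply, Equiv.symm_apply_apply,
      Matrix.blockDiagonal_apply, Matrix.of_apply]
    split_ifs with hl
    · change ℓ = ℓ' at hl
      subst hl
      exact lemniscate_moment_diag s hd t ℓ a b
    · refine lemniscate_moment_offDiag s hd t ?_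
      simp only [finProdFinEquiv_apply_val, Nat.add_mul_mod_self_left,
        Nat.mod_eq_of_lt ℓ.2, Nat.mod_eq_of_lt ℓ'.2]
      exact fun h => hl (Fin.ext h)
  rw [hM, Matrix.det_submatrix_equiv_self, Matrix.det_blockDiagonal] at h
  -- Andréief's identity read backwards: each block determinant is an N-point integral divided by
  -- N!.
  have hfac : ∀ ℓ : Fin d, (μ ℓ).det =
      ((shiftedPartition N (gammaExponent d ℓ) s t / N.factorial : ℝ) : ℂ) := by
    intro ℓ
    have h1 := integral_prod_mul_vandermonde_sq (n := N)
      fun a b => integrable_shiftedWeight_moment (gammaExponent_gt (ℓ := ℓ) hd) hs t a b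
    change ((shiftedPartition N (gammaExponent d ℓ) s t : ℝ) : ℂ) = _ * (μ ℓ).det at h1
    have h2 : (N.factorial : ℂ) ≠ 0 := by exact_mod_cast N.factorial_ne_zero
    rw [Complex.ofReal_div, h1, Complex.ofReal_natCast]
    field_simp
  simp_rw [Matrix.det_smul, Fintype.card_fin, hfac] at h
  change ((partitionFunction (N * d) (lemniscatePotential d t) : ℝ) : ℂ) = _ at h
  rw [← Fin.prod_univ_eq_prod_range (fun ℓ => (Real.exp (s * t ^ 2) / d) ^ N *
          (shiftedPartition N (gammaExponent d ℓ) s t / N.factorial))]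
  refine Complex.ofReal_injective ?_
  rw [h]
  push_cast
  rfl

/-- The integral of `∏ⱼ ‖vⱼ - x‖ ^ γ exp (-N ‖vⱼ‖ ^ 2)` against the squared Vandermonde. -/
noncomputable def ginibreEigenIntegrand (N : ℕ) (γ : ℝ) (x : ℂ) (v : Fin N → ℂ) : ℝ :=
  (∏ j, ‖v j - x‖ ^ γ) * weight N ginibrePotential v

/-- With u = t - v/√d one has u = -(v - t√d)/√d and u - t = -v/√d: the singularity moves from 0 to
t√d, and the Gaussian rate drops from Nd to N. -/
lemma shiftedWeight_comp_affine {N d : ℕ} (hd : 1 ≤ d) (γ t : ℝ) (v : ℂ) :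
    shiftedWeight γ (N * d : ℕ) t (t + (-(Real.sqrt d)⁻¹) • v) =
      (d : ℝ) ^ (-(γ / 2)) * (‖v - ((t * Real.sqrt d : ℝ) : ℂ)‖ ^ γ *
        Real.exp (-(N : ℝ) * ginibrePotential v)) := by
  have hd0 : (0 : ℝ) < d := by positivity
  have hsq : Real.sqrt d ^ 2 = d := Real.sq_sqrt hd0.le
  have hs0 : 0 < Real.sqrt d := Real.sqrt_pos.2 hd0
  have hsC : ((Real.sqrt d : ℝ) : ℂ) ≠ 0 := by exact_mod_cast hs0.ne'
  have e1 : (t : ℂ) + (-(Real.sqrt d)⁻¹) • v =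
      (-(Real.sqrt d)⁻¹) • (v - ((t * Real.sqrt d : ℝ) : ℂ)) := by
    simp only [Complex.real_smul]
    push_cast
    field_simp
    ring
  rw [shiftedWeight, add_sub_cancel_left, e1, norm_smul, norm_smul, norm_neg, norm_inv,
    Real.norm_of_nonneg hs0.le, Real.mul_rpow (by positivity) (by positivity), Real.sqrt_eq_rpow,
    ← Real.rpow_neg hd0.le, ← Real.rpow_mul hd0.le, mul_pow,
    ← Real.rpow_natCast (_ ^ (-(1 / 2 : ℝ))),
    ← Real.rpow_mul hd0.le, ginibrePotential, mul_assoc]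
  congr 3
  · ring
  · have : (-(1 / 2 : ℝ)) * ((2 : ℕ) : ℝ) = -1 := by norm_num
    rw [this, Real.rpow_neg_one]
    push_cast
    field_simp

/-- The integrand of `shiftedPartition`. -/
noncomputable def shiftedIntegrand (N : ℕ) (γ s t : ℝ) (u : Fin N → ℂ) : ℝ :=
  (∏ j, shiftedWeight γ s t (u j)) * ∏ i, ∏ j ∈ Finset.Ioi i, ‖u j - u i‖ ^ 2

/-- Each of the N(N-1)/2 pairs in the squared Vandermonde contributes 1/d, and each of the N weights
contributes d^(-γ/2). -/
lemma shiftedIntegrand_comp_affine {N d : ℕ} (hd : 1 ≤ d) (γ t : ℝ) (v : Fin N → ℂ) :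
    shiftedIntegrand N γ (N * d : ℕ) t ((fun _ => (t : ℂ)) + (-(Real.sqrt d)⁻¹) • v) =
      (d : ℝ) ^ (-((N : ℝ) * (N - 1) / 2 + N * γ / 2)) *
        ginibreEigenIntegrand N γ ((t * Real.sqrt d : ℝ) : ℂ) v := by
  have hd0 : (0 : ℝ) < d := by positivity
  set R : ℝ := -(Real.sqrt d)⁻¹ with hR
  have hR2 : R ^ 2 = (d : ℝ)⁻¹ := by
    rw [hR, neg_sq, inv_pow, Real.sq_sqrt hd0.le]
  have e1 : ∏ j, shiftedWeight γ (N * d : ℕ) t (((fun _ => (t : ℂ)) + R • v : Fin N → ℂ) j) =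
      (d : ℝ) ^ (-(N * γ / 2)) * ∏ j, (‖v j - ((t * Real.sqrt d : ℝ) : ℂ)‖ ^ γ *
        Real.exp (-(N : ℝ) * ginibrePotential (v j))) := by
    simp only [Pi.add_apply, Pi.smul_apply]
    rw [Finset.prod_congr rfl fun j _ => shiftedWeight_comp_affine hd γ t (v j),
      Finset.prod_mul_distrib, Finset.prod_const, Finset.card_univ, Fintype.card_fin,
      ← Real.rpow_natCast, ← Real.rpow_mul hd0.le]
    congr 2
    ring
  have e2 : ∏ i, ∏ j ∈ Finset.Ioi i, ‖((fun _ => (t : ℂ)) + R • v : Fin N → ℂ) j -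
      ((fun _ => (t : ℂ)) + R • v : Fin N → ℂ) i‖ ^ 2 =
      (d : ℝ) ^ (-((N : ℝ) * (N - 1) / 2)) * ∏ i, ∏ j ∈ Finset.Ioi i, ‖v j - v i‖ ^ 2 := by
    have e3 : ∀ i j, ‖((fun _ => (t : ℂ)) + R • v : Fin N → ℂ) j -
        ((fun _ => (t : ℂ)) + R • v : Fin N → ℂ) i‖ ^ 2 = (d : ℝ)⁻¹ * ‖v j - v i‖ ^ 2 := by
      intro i j
      simp only [Pi.add_apply, Pi.smul_apply, add_sub_add_left_eq_sub]
      rw [← smul_sub, norm_smul, mul_pow, Real.norm_eq_abs, sq_abs, hR2]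
    simp_rw [e3, Finset.prod_mul_distrib, Finset.prod_const, Fin.card_Ioi]
    congr 1
    rw [Finset.prod_pow_eq_pow_sum, Real.rpow_neg hd0.le, inv_pow]
    congr 1
    rw [← Real.rpow_natCast]
    congr 1
    rw [← sum_fin_val_real, ← Finset.sum_range_reflect,
      Fin.sum_univ_eq_sum_range (fun i => N - 1 - i) N]
    push_cast
    rfl
  simp only [shiftedIntegrand, e1, e2, ginibreEigenIntegrand, weight]
  rw [neg_add, Real.rpow_add hd0, Finset.prod_mul_distrib]
  ring

lemma integrable_ginibreEigenIntegrand {N d : ℕ} (hN : 1 ≤ N) (hd : 1 ≤ d) {γ : ℝ} (hγ : -2 < γ)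
    (t : ℝ) : Integrable (ginibreEigenIntegrand N γ ((t * Real.sqrt d : ℝ) : ℂ)) := by
  have hd0 : (0 : ℝ) < d := by positivity
  have hF : Integrable (shiftedIntegrand N γ (N * d : ℕ) t) :=
    integrable_prod_mul_vandermonde_sq fun a b =>
      integrable_shiftedWeight_moment hγ (s := (N * d : ℕ)) (by positivity) t a b
  have hR : -(Real.sqrt d)⁻¹ ≠ 0 := neg_ne_zero.2 (inv_ne_zero (Real.sqrt_pos.2 hd0).ne')
  have h := (hF.comp_add_left fun _ => (t : ℂ)).comp_smul hR
  simp_rw [shiftedIntegrand_comp_affine hd] at h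
  have hne : (d : ℝ) ^ (-((N : ℝ) * (N - 1) / 2 + N * γ / 2)) ≠ 0 :=
    (Real.rpow_pos_of_pos hd0 _).ne'
  exact (integrable_const_mul_iff (isUnit_iff_ne_zero.2 hne) _).1 h

/-- The additional d^(-N) is the Jacobian of scaling by d^(-1/2) in real dimension 2N. -/
theorem shiftedPartition_eq {N d : ℕ} (hd : 1 ≤ d) (γ t : ℝ) :
    shiftedPartition N γ (N * d : ℕ) t =
      (d : ℝ) ^ (-((N : ℝ) + N * (N - 1) / 2 + N * γ / 2)) *
        ∫ v, ginibreEigenIntegrand N γ ((t * Real.sqrt d : ℝ) : ℂ) v := by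
  have hd0 : (0 : ℝ) < d := by positivity
  have hs0 : 0 < Real.sqrt d := Real.sqrt_pos.2 hd0
  set R : ℝ := -(Real.sqrt d)⁻¹ with hR
  set F : (Fin N → ℂ) → ℝ := shiftedIntegrand N γ (N * d : ℕ) t with hF
  have h1 : ∫ v : Fin N → ℂ, F ((fun _ => (t : ℂ)) + R • v) =
      |(R ^ Module.finrank ℝ (Fin N → ℂ))⁻¹| • ∫ u, F u := by
    rw [Measure.integral_comp_smul volume (fun u => F ((fun _ => (t : ℂ)) + u)) R,
      integral_add_left_eq_self]
  have hfr : Module.finrank ℝ (Fin N → ℂ) = N * 2 := by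
    rw [Module.finrank_pi_fintype]
    simp [Complex.finrank_real_complex]
  have hR2 : R ^ 2 = (d : ℝ)⁻¹ := by
    rw [hR, neg_sq, inv_pow, Real.sq_sqrt hd0.le]
  simp_rw [hF, hR, shiftedIntegrand_comp_affine hd, ← hR, ← hF] at h1
  rw [integral_const_mul, hfr, mul_comm N 2, pow_mul, hR2, smul_eq_mul, inv_pow, inv_inv,
    abs_of_pos (by positivity)] at h1
  change _ = _ * shiftedPartition N γ (N * d : ℕ) t at h1
  have e : (d : ℝ) ^ (-((N : ℝ) + N * (N - 1) / 2 + N * γ / 2)) =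
      ((d : ℝ) ^ N)⁻¹ * (d : ℝ) ^ (-((N : ℝ) * (N - 1) / 2 + N * γ / 2)) := by
    rw [← Real.rpow_natCast, ← Real.rpow_neg hd0.le, ← Real.rpow_add hd0]
    congr 1
    ring
  rw [e, mul_assoc, h1]
  field_simp

end Reduction

/-! ### Block matrices with a prescribed eigenvector. -/

section LinearAlgebra

open Matrix
open scoped ComplexConjugate

variable {n : ℕ}

/-- The value at `x` of the characteristic polynomial of a matrix given by its entries. -/
noncomputable def charDet (x : ℂ) (A : Fin n → Fin n → ℂ) : ℂ :=
  (x • (1 : Matrix (Fin n) (Fin n) ℂ) - of A).det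

/-- The squared Frobenius norm. -/
noncomputable def frobSq {ι κ : Type*} [Fintype ι] [Fintype κ] (A : ι → κ → ℂ) : ℝ :=
  ∑ i, ∑ j, ‖A i j‖ ^ 2

/-- The matrix with first row `(a, w)`, first column `(a, c)` and remaining block `D`. -/
def blk (a : ℂ) (w c : Fin n → ℂ) (D : Fin n → Fin n → ℂ) : Fin (n + 1) → Fin (n + 1) → ℂ :=
  Fin.cons (Fin.cons a w) fun i => Fin.cons (c i) (D i)

/-- The resolvent vector `adj (x - D) v`. -/
noncomputable def adjVec (x : ℂ) (D : Fin n → Fin n → ℂ) (v : Fin n → ℂ) : Fin n → ℂ :=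
  (x • (1 : Matrix (Fin n) (Fin n) ℂ) - of D).adjugate *ᵥ v

/-- Translate of `B` by the rank one matrix `q ⊗ w`. -/
def rankOneAdd (q w : Fin n → ℂ) (B : Fin n → Fin n → ℂ) : Fin n → Fin n → ℂ :=
  fun i j => B i j + q i * w j

/-- The matrix with eigenvector `(1, q)`, eigenvalue `x`, first row `w` off the diagonal, and
quotient `B`. -/
noncomputable def eigBlk (x : ℂ) (q w : Fin n → ℂ) (B : Fin n → Fin n → ℂ) :
    Fin (n + 1) → Fin (n + 1) → ℂ :=
  blk (x - w ⬝ᵥ q) w (x • q - of (rankOneAdd q w B) *ᵥ q) (rankOneAdd q w B)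

/-- The splitting of the index set `Fin (n + 1)` into its first element and the others. -/
def splitFirst (n : ℕ) : Unit ⊕ Fin n ≃ Fin (n + 1) where
  toFun := Sum.elim (fun _ => 0) Fin.succ
  invFun := Fin.cases (Sum.inl ()) Sum.inr
  left_inv := by rintro (_ | _) <;> rfl
  right_inv := by
    intro i
    refine Fin.cases rfl (fun i => rfl) i

lemma of_blk_submatrix (a : ℂ) (w c : Fin n → ℂ) (D : Fin n → Fin n → ℂ) :
    (of (blk a w c D)).submatrix (splitFirst n) (splitFirst n) =
      fromBlocks (of fun _ _ => a) (of fun _ j => w j) (of fun i _ => c i) (of D) := by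
  ext (i | i) (j | j) <;> rfl

lemma frobSq_blk (a : ℂ) (w c : Fin n → ℂ) (D : Fin n → Fin n → ℂ) :
    frobSq (blk a w c D) = frobSq ((of (blk a w c D)).submatrix (splitFirst n) (splitFirst n)) := by
  unfold frobSq
  rw [← (splitFirst n).sum_comp]
  refine Finset.sum_congr rfl fun i _ => ?_
  rw [← (splitFirst n).sum_comp]
  rfl

lemma charDet_blk (x a : ℂ) (w c : Fin n → ℂ) (D : Fin n → Fin n → ℂ) :
    charDet x (blk a w c D) = (fromBlocks (of fun _ _ => x - a) (of fun _ j => - w j)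
      (of fun i _ => - c i) (x • (1 : Matrix (Fin n) (Fin n) ℂ) - of D) :
        Matrix (Unit ⊕ Fin n) (Unit ⊕ Fin n) ℂ).det := by
  rw [charDet, ← det_submatrix_equiv_self (splitFirst n)]
  congr 1
  simp only [submatrix_sub, submatrix_smul, Pi.sub_apply, Pi.smul_apply, submatrix_one_equiv,
    of_blk_submatrix]
  ext (i | i) (j | j) <;> simp [one_apply]

lemma inv_eq_smul_adjugate {A : Matrix (Fin n) (Fin n) ℂ} : A⁻¹ = (A.det)⁻¹ • A.adjugate := by
  rw [Matrix.inv_def, Ring.inverse_eq_inv']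

/-- Schur complement of the block x - D, with the resolvent written as adjugate over determinant. -/
lemma charDet_blk_of_ne_zero {x : ℂ} {D : Fin n → Fin n → ℂ} (hx : charDet x D ≠ 0) (a : ℂ)
    (w c : Fin n → ℂ) :
    charDet x (blk a w c D) = charDet x D * (x - a - (w ⬝ᵥ adjVec x D c) / charDet x D) := by
  have hu : IsUnit (x • (1 : Matrix (Fin n) (Fin n) ℂ) - of D) :=
    (isUnit_iff_isUnit_det _).2 (isUnit_iff_ne_zero.2 hx)
  let := hu.invertible
  rw [charDet_blk, det_fromBlocks₂₂, ← charDet]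
  congr 1
  rw [det_unique, invOf_eq_nonsing_inv, inv_eq_smul_adjugate, ← charDet, adjVec]
  simp only [Matrix.sub_apply, of_apply, Matrix.mul_assoc, smul_mul]
  congr 1
  rw [div_eq_inv_mul]
  simp only [mul_apply, mulVec, dotProduct, of_apply, neg_mul, mul_neg, Finset.sum_neg_distrib,
    neg_neg, Matrix.smul_apply, smul_eq_mul, Finset.mul_sum]
  refine Finset.sum_congr rfl fun i _ => ?_
  exact Finset.sum_congr rfl fun j _ => mul_left_comm _ _ _

/-- In the basis that replaces the first vector by (1, q), the eigenvector equation makes the matrix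
block upper triangular with diagonal blocks x and B. -/
lemma blk_eig_factor (x : ℂ) (q w : Fin n → ℂ) (B : Fin n → Fin n → ℂ) :
    (of (eigBlk x q w B)).submatrix (splitFirst n) (splitFirst n) =
      (fromBlocks 1 0 (of fun i _ => q i) 1 : Matrix (Unit ⊕ Fin n) (Unit ⊕ Fin n) ℂ) *
      fromBlocks (of fun _ _ => x) (of fun _ j => w j) 0 (of B) *
      fromBlocks 1 0 (of fun i _ => - q i) 1 := by
  rw [eigBlk, of_blk_submatrix, fromBlocks_multiply, fromBlocks_multiply]
  congr 1
  · ext i j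
    simp [mul_apply, dotProduct, sub_eq_add_neg]
  · ext i j
    simp
  · ext i j
    simp [mul_apply, mulVec, dotProduct, rankOneAdd]
    ring_nf
  · ext i j
    simp [mul_apply, rankOneAdd, add_comm]

lemma charDet_eigBlk (y x : ℂ) (q w : Fin n → ℂ) (B : Fin n → Fin n → ℂ) :
    charDet y (eigBlk x q w B) = (y - x) * charDet y B := by
  have hLL : (fromBlocks 1 0 (of fun i _ => q i) 1 : Matrix (Unit ⊕ Fin n) (Unit ⊕ Fin n) ℂ) *
      fromBlocks 1 0 (of fun i _ => - q i) 1 = 1 := by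
    rw [fromBlocks_multiply, ← fromBlocks_one]
    congr 1 <;> ext i j <;> simp
  rw [charDet, ← det_submatrix_equiv_self (splitFirst n), submatrix_sub, submatrix_smul]
  simp only [Pi.sub_apply, Pi.smul_apply, submatrix_one_equiv]
  rw [blk_eig_factor, ← hLL]
  have : y • ((fromBlocks 1 0 (of fun i _ => q i) 1 : Matrix (Unit ⊕ Fin n) (Unit ⊕ Fin n) ℂ) *
      fromBlocks 1 0 (of fun i _ => - q i) 1) -
      (fromBlocks 1 0 (of fun i _ => q i) 1 : Matrix (Unit ⊕ Fin n) (Unit ⊕ Fin n) ℂ) *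
      fromBlocks (of fun _ _ => x) (of fun _ j => w j) 0 (of B) *
      fromBlocks 1 0 (of fun i _ => - q i) 1 =
      (fromBlocks 1 0 (of fun i _ => q i) 1 : Matrix (Unit ⊕ Fin n) (Unit ⊕ Fin n) ℂ) *
      fromBlocks (of fun _ _ => y - x) (of fun _ j => - w j) 0
        (y • (1 : Matrix (Fin n) (Fin n) ℂ) - of B) *
      fromBlocks 1 0 (of fun i _ => - q i) 1 := by
    have h2 : (fromBlocks (of fun _ _ => y - x) (of fun _ j => - w j) 0
        (y • (1 : Matrix (Fin n) (Fin n) ℂ) - of B) : Matrix (Unit ⊕ Fin n) (Unit ⊕ Fin n) ℂ) =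
        y • 1 - fromBlocks (of fun _ _ => x) (of fun _ j => w j) 0 (of B) := by
      ext (i | i) (j | j) <;> simp [one_apply]
    rw [h2, Matrix.mul_sub, Matrix.sub_mul, Matrix.mul_smul, Matrix.mul_one, Matrix.smul_mul]
  rw [this, det_mul, det_mul, det_fromBlocks_zero₂₁, det_fromBlocks_zero₁₂, det_fromBlocks_zero₁₂]
  simp [charDet]

/-- The matrix determinant lemma: one bordered matrix is expanded by both of its Schur complements.
It will merge the two Jacobians of the change of variables into a single characteristic polynomial.
-/
lemma charDet_add_rankOne {x : ℂ} {q w : Fin n → ℂ} {D : Fin n → Fin n → ℂ}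
    (hx : charDet x D ≠ 0) :
    charDet x (rankOneAdd (-q) w D) = charDet x D * (1 + (w ⬝ᵥ adjVec x D q) / charDet x D) := by
  have h1 : charDet x (rankOneAdd (-q) w D) =
      (fromBlocks (1 : Matrix Unit Unit ℂ) (of fun _ j => w j) (of fun i _ => - q i)
        (x • (1 : Matrix (Fin n) (Fin n) ℂ) - of D)).det := by
    rw [det_fromBlocks_one₁₁, charDet]
    congr 1
    ext i j
    simp [rankOneAdd, mul_apply]
    ring
  -- The corner x - 1 makes the upper left entry of the bordered matrix equal to 1.
  have h2 := charDet_blk_of_ne_zero hx (x - 1) (-w) q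
  rw [charDet_blk] at h2
  rw [h1]
  convert! h2 using 2
  · congr 1
    · ext i j
      obtain rfl : i = j := rfl
      simp
    · ext; simp
  · rw [neg_dotProduct]
    ring

lemma frobSq_eq_trace {ι : Type*} [Fintype ι] (A : Matrix ι ι ℂ) :
    ((frobSq fun i j => A i j : ℝ) : ℂ) = (Aᴴ * A).trace := by
  simp only [frobSq, trace, diag, mul_apply, conjTranspose_apply]
  rw [Finset.sum_comm]
  push_cast
  refine Finset.sum_congr rfl fun i _ => Finset.sum_congr rfl fun j _ => ?_
  rw [mul_comm, RCLike.star_def, Complex.mul_conj, Complex.normSq_eq_norm_sq]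
  push_cast
  rfl

lemma frobSq_unitary_conj {ι : Type*} [Fintype ι] [DecidableEq ι] {U : Matrix ι ι ℂ}
    (hU : Uᴴ * U = 1) (A : Matrix ι ι ℂ) :
    (frobSq fun i j => (Uᴴ * A * U) i j) = frobSq fun i j => A i j := by
  have hU' : U * Uᴴ = 1 := mul_eq_one_comm.1 hU
  refine Complex.ofReal_injective ?_
  rw [frobSq_eq_trace, frobSq_eq_trace, conjTranspose_mul, conjTranspose_mul,
    conjTranspose_conjTranspose]
  have : Uᴴ * (Aᴴ * U) * (Uᴴ * A * U) = Uᴴ * (Aᴴ * A * U) := by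
    calc Uᴴ * (Aᴴ * U) * (Uᴴ * A * U) = Uᴴ * Aᴴ * (U * Uᴴ) * A * U := by
          simp only [Matrix.mul_assoc]
      _ = _ := by rw [hU']; simp only [Matrix.mul_assoc, Matrix.one_mul]
  rw [this, trace_mul_comm, Matrix.mul_assoc, hU', Matrix.mul_one]

/-- A unitary matrix whose first column is proportional to `(1, q)`. -/
lemma exists_unitary_first_column (q : Fin n → ℂ) :
    ∃ (U : Matrix (Unit ⊕ Fin n) (Unit ⊕ Fin n) ℂ) (ρ : ℂ), Uᴴ * U = 1 ∧ ρ ≠ 0 ∧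
      ∀ i, U i (Sum.inl ()) * ρ = Sum.elim (fun _ => 1) q i := by
  set v : EuclideanSpace ℂ (Unit ⊕ Fin n) := WithLp.toLp 2 (Sum.elim (fun _ => 1) q) with hv
  have hv0 : v ≠ 0 := by
    intro h
    have := congrArg (fun u : EuclideanSpace ℂ (Unit ⊕ Fin n) => u (Sum.inl ())) h
    simp [hv] at this
  have hn : ‖v‖ ≠ 0 := norm_ne_zero_iff.2 hv0
  have horth : Orthonormal ℂ (({Sum.inl ()} : Set (Unit ⊕ Fin n)).domRestrict
      fun _ => ((‖v‖⁻¹ : ℝ) : ℂ) • v) := by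
    constructor
    · intro i
      simp [norm_smul, hn]
    · intro i j hij
      exact absurd (Subsingleton.elim i j) hij
  obtain ⟨b, hb⟩ := horth.exists_orthonormalBasis_extension_of_card_eq (by simp)
  refine ⟨of fun i j => b j i, ((‖v‖ : ℝ) : ℂ), ?_, by exact_mod_cast hn, fun i => ?_⟩
  · ext i j
    have := orthonormal_iff_ite.1 b.orthonormal i j
    simp only [mul_apply, conjTranspose_apply, of_apply, one_apply]
    rw [← this, PiLp.inner_apply]
    refine Finset.sum_congr rfl fun k _ => ?_
    simp [mul_comm]
  · rw [of_apply, hb (Sum.inl ()) rfl]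
    have hnC : ((‖v‖ : ℝ) : ℂ) ≠ 0 := by exact_mod_cast hn
    simp only [PiLp.smul_apply, smul_eq_mul, Complex.ofReal_inv]
    field_simp
    rw [hv]

/-- In a suitable unitary frame the matrix `eigBlk x q w B` becomes block triangular, with lower
block similar to `B`. -/
lemma exists_frobSq_eigBlk_eq (q : Fin n → ℂ) :
    ∃ (ρ : ℂ) (s : Fin n → ℂ) (S : Matrix (Fin n) (Fin n) ℂ), ρ ≠ 0 ∧ IsUnit S.det ∧
      ∀ (x : ℂ) (w : Fin n → ℂ) (B : Fin n → Fin n → ℂ), frobSq (eigBlk x q w B) =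
        ‖x‖ ^ 2 + ∑ j, ‖((ρ • w + (s ᵥ* of B - x • s)) ᵥ* S⁻¹) j‖ ^ 2 +
          frobSq fun i j => (S * of B * S⁻¹) i j := by
  obtain ⟨U, ρ, hU, hρ, hUρ⟩ := exists_unitary_first_column q
  set L : Matrix (Unit ⊕ Fin n) (Unit ⊕ Fin n) ℂ := fromBlocks 1 0 (of fun i _ => q i) 1 with hL
  set R := Uᴴ * L with hR
  have hLL : L * fromBlocks 1 0 (of fun i _ => - q i) 1 = 1 := by
    rw [hL, fromBlocks_multiply, ← fromBlocks_one]
    congr 1 <;> ext i j <;> simp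
  -- The first column of L is ρ times that of the unitary U, so R = UᴴL has first column ρ e₁ and is
  -- block upper triangular. Hence so is X = R T R⁻¹, whose Frobenius norm equals that of the
  -- original matrix.
  have hRcol : ∀ i, R i (Sum.inl ()) = ρ * (1 : Matrix (Unit ⊕ Fin n) (Unit ⊕ Fin n) ℂ) i
      (Sum.inl ()) := by
    intro i
    rw [← hU, hR, mul_apply, mul_apply, Finset.mul_sum]
    refine Finset.sum_congr rfl fun k _ => ?_
    have : L k (Sum.inl ()) = U k (Sum.inl ()) * ρ := by
      rw [hUρ]
      rcases k with k | k <;> simp [hL]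
    rw [this]
    ring
  set s : Fin n → ℂ := fun j => R (Sum.inl ()) (Sum.inr j) with hs
  set S : Matrix (Fin n) (Fin n) ℂ := R.toBlocks₂₂ with hS
  have hRb : R = fromBlocks (of fun _ _ => ρ) (of fun _ j => s j) 0 S := by
    ext (i | i) (j | j)
    · simpa using hRcol (Sum.inl i)
    · rfl
    · simpa using hRcol (Sum.inr i)
    · rfl
  have hdetR : IsUnit R.det := by
    rw [hR, det_mul]
    refine IsUnit.mul ?_ ?_
    · exact isUnit_of_mul_isUnit_left (by rw [← det_mul, hU, det_one]; exact isUnit_one)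
    · exact isUnit_of_mul_isUnit_left (by rw [← det_mul, hLL, det_one]; exact isUnit_one)
  have hSdet : IsUnit S.det := by
    rw [hRb, det_fromBlocks_zero₂₁] at hdetR
    exact isUnit_of_mul_isUnit_right hdetR
  refine ⟨ρ, s, S, hρ, hSdet, fun x w B => ?_⟩
  set A := (of (eigBlk x q w B)).submatrix (splitFirst n) (splitFirst n) with hA
  set T : Matrix (Unit ⊕ Fin n) (Unit ⊕ Fin n) ℂ :=
    fromBlocks (of fun _ _ => x) (of fun _ j => w j) 0 (of B) with hT
  have hAL : A * L = L * T := by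
    rw [hA, blk_eig_factor, Matrix.mul_assoc, mul_eq_one_comm.1 hLL, Matrix.mul_one]
  set X := Uᴴ * A * U with hX
  have hU' : U * Uᴴ = 1 := mul_eq_one_comm.1 hU
  have hXR : X * R = R * T := by
    calc X * R = Uᴴ * A * (U * Uᴴ) * L := by simp only [hX, hR, Matrix.mul_assoc]
      _ = Uᴴ * (A * L) := by rw [hU', Matrix.mul_one, Matrix.mul_assoc]
      _ = R * T := by rw [hAL, hR, Matrix.mul_assoc]
  have hY : fromBlocks (of fun _ _ => x)
      (of fun _ j => ((ρ • w + (s ᵥ* of B - x • s)) ᵥ* S⁻¹) j) 0 (S * of B * S⁻¹) * R = R * T := by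
    rw [hRb, hT, fromBlocks_multiply, fromBlocks_multiply]
    have h1 : S * of B * S⁻¹ * S = S * of B := by
      rw [Matrix.mul_assoc, nonsing_inv_mul S hSdet, Matrix.mul_one]
    have h2 : (of fun (_ : Unit) j => ((ρ • w + (s ᵥ* of B - x • s)) ᵥ* S⁻¹) j) * S =
        of fun _ j => (ρ • w + (s ᵥ* of B - x • s)) j := by
      ext i j
      have : ((ρ • w + (s ᵥ* of B - x • s)) ᵥ* S⁻¹) ᵥ* S = ρ • w + (s ᵥ* of B - x • s) := by
        rw [vecMul_vecMul, nonsing_inv_mul S hSdet, vecMul_one]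
      exact congrFun this j
    rw [h1, h2]
    congr 1
    · ext; simp [mul_apply, mul_comm]
    · ext i j
      simp [mul_apply, vecMul, dotProduct]
      ring
    · simp
    · simp
  have hXY : X = fromBlocks (of fun _ _ => x)
      (of fun _ j => ((ρ • w + (s ᵥ* of B - x • s)) ᵥ* S⁻¹) j) 0 (S * of B * S⁻¹) := by
    have h := hXR.trans hY.symm
    have := congrArg (fun M => M * R⁻¹) h
    simpa only [Matrix.mul_assoc, mul_nonsing_inv R hdetR, Matrix.mul_one] using this
  have hfr : frobSq (eigBlk x q w B) = frobSq fun i j => X i j := by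
    rw [hX, frobSq_unitary_conj hU, eigBlk, frobSq_blk]
    rfl
  rw [hfr, hXY]
  simp [frobSq, Fintype.sum_sum_type]

end LinearAlgebra

/-! ### Lebesgue measure in block coordinates, and genericity. -/

section BlockMeasure

open Matrix
open scoped ENNReal

variable {n : ℕ}

lemma measurable_blk : Measurable fun p : (ℂ × (Fin n → ℂ)) × (Fin n → ℂ) × (Fin n → Fin n → ℂ) =>
    blk p.1.1 p.1.2 p.2.1 p.2.2 := by
  refine measurable_pi_iff.2 fun i => measurable_pi_iff.2 fun j => ?_
  refine Fin.cases ?_ (fun i => ?_) i <;> refine Fin.cases ?_ (fun j => ?_) j <;>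
    simp only [blk, Fin.cons_zero, Fin.cons_succ] <;> fun_prop

lemma measurePreserving_cons (X : Type*) [MeasureSpace X] [SigmaFinite (volume : Measure X)] :
    MeasurePreserving (fun p : X × (Fin n → X) => (Fin.cons p.1 p.2 : Fin (n + 1) → X)) := by
  have h := (volume_preserving_piFinSuccAbove (fun _ : Fin (n + 1) => X) 0).symm
  convert! h using 1
  ext p
  simp [MeasurableEquiv.piFinSuccAbove, Fin.insertNthEquiv]

lemma measurePreserving_blk : MeasurePreserving
    fun p : (ℂ × (Fin n → ℂ)) × (Fin n → ℂ) × (Fin n → Fin n → ℂ) =>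
      blk p.1.1 p.1.2 p.2.1 p.2.2 := by
  have h1 : MeasurePreserving fun p : (Fin n → ℂ) × (Fin n → Fin n → ℂ) =>
      fun i => (Fin.cons (p.1 i) (p.2 i) : Fin (n + 1) → ℂ) :=
    (volume_preserving_pi fun _ : Fin n => measurePreserving_cons (n := n) ℂ).comp
      (volume_measurePreserving_arrowProdEquivProdArrow ℂ (Fin n → ℂ) (Fin n)).symm
  exact (measurePreserving_cons (n := n) (Fin (n + 1) → ℂ)).comp
    ((measurePreserving_cons (n := n) ℂ).prod h1)

/-- The corner is integrated innermost, so that with D, w, c fixed it can be traded for an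
eigenvalue by the one-variable area formula. -/
theorem lintegral_blk (F : (Fin (n + 1) → Fin (n + 1) → ℂ) → ℝ≥0∞) (hF : Measurable F) :
    ∫⁻ A, F A = ∫⁻ D : Fin n → Fin n → ℂ, ∫⁻ w : Fin n → ℂ, ∫⁻ c : Fin n → ℂ, ∫⁻ a : ℂ,
      F (blk a w c D) := by
  rw [← measurePreserving_blk.lintegral_comp hF]
  have hm : Measurable fun p : (ℂ × (Fin n → ℂ)) × (Fin n → ℂ) × (Fin n → Fin n → ℂ) =>
      F (blk p.1.1 p.1.2 p.2.1 p.2.2) := hF.comp measurable_blk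
  refine (lintegral_prod_symm _ hm.aemeasurable).trans ?_
  refine (lintegral_prod_symm _ hm.lintegral_prod_left'.aemeasurable).trans ?_
  refine lintegral_congr fun D => ?_
  have hmD : Measurable fun p : (Fin n → ℂ) × (ℂ × (Fin n → ℂ)) => F (blk p.2.1 p.2.2 p.1 D) :=
    hm.comp
      (f := fun p : (Fin n → ℂ) × (ℂ × (Fin n → ℂ)) => (p.2, (p.1, D))) (by fun_prop)
  refine (lintegral_lintegral_swap hmD.aemeasurable).trans ?_
  refine (lintegral_prod_symm _ hmD.lintegral_prod_left'.aemeasurable).trans ?_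
  refine lintegral_congr fun w => ?_
  have hmw : Measurable fun p : ℂ × (Fin n → ℂ) => F (blk p.1 w p.2 D) :=
    hmD.comp (f := fun p : ℂ × (Fin n → ℂ) => (p.2, (p.1, w))) (by fun_prop)
  exact lintegral_lintegral_swap hmw.aemeasurable

/-- Existence over a `σ`-compact fibre of a closed condition is measurable. -/
lemma measurableSet_exists_of_isClosed {X : Type*} [TopologicalSpace X] [MeasurableSpace X]
    [BorelSpace X] {S : Set (X × ℂ)} (hS : IsClosed S) : MeasurableSet {x | ∃ μ, (x, μ) ∈ S} := by
  have h : {x | ∃ μ, (x, μ) ∈ S} = ⋃ k : ℕ, Prod.fst ''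
      ((fun p : X × Metric.closedBall (0 : ℂ) k => (p.1, (p.2 : ℂ))) ⁻¹' S) := by
    ext x
    simp only [Set.mem_ofPred_eq, Set.mem_iUnion, Set.mem_image, Set.mem_preimage, Prod.exists,
      exists_and_right, exists_eq_right]
    constructor
    · rintro ⟨μ, hμ⟩
      obtain ⟨k, hk⟩ := exists_nat_ge ‖μ‖
      exact ⟨k, ⟨μ, by simpa using hk⟩, hμ⟩
    · rintro ⟨k, μ, hμ⟩
      exact ⟨μ, hμ⟩
  rw [h]
  refine MeasurableSet.iUnion fun k => IsClosed.measurableSet ?_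
  exact isClosedMap_fst_of_compactSpace _ (hS.preimage (by fun_prop))

/-- No eigenvalue of `D` annihilates the adjugate of `μ - D`, that is, `D` is nonderogatory. -/
def Nonderogatory (D : Fin n → Fin n → ℂ) : Prop :=
  ∀ μ, charDet μ D = 0 → (μ • (1 : Matrix (Fin n) (Fin n) ℂ) - of D).adjugate ≠ 0

/-- Needed because the exceptional set is shown to be null by iterated integration of its indicator.
-/
lemma measurableSet_nonderogatory : MeasurableSet {D : Fin n → Fin n → ℂ | Nonderogatory D} := by
  have hc : Continuous fun p : (Fin n → Fin n → ℂ) × ℂ =>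
      p.2 • (1 : Matrix (Fin n) (Fin n) ℂ) - of p.1 := by
    have h1 : Continuous fun p : (Fin n → Fin n → ℂ) × ℂ => (of p.1 : Matrix (Fin n) (Fin n) ℂ) :=
      continuous_fst
    fun_prop
  have hcl : IsClosed {p : (Fin n → Fin n → ℂ) × ℂ | charDet p.2 p.1 = 0 ∧
      (p.2 • (1 : Matrix (Fin n) (Fin n) ℂ) - of p.1).adjugate = 0} :=
    (isClosed_eq hc.matrix_det continuous_const).inter
      (isClosed_eq hc.matrix_adjugate continuous_const)
  convert! (measurableSet_exists_of_isClosed hcl).compl using 1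
  ext D
  simp [Nonderogatory]

lemma eval_charpoly_eq_charDet (x : ℂ) (A : Fin n → Fin n → ℂ) :
    (of A).charpoly.eval x = charDet x A := by
  rw [Matrix.eval_charpoly, charDet, smul_one_eq_diagonal]
  rfl

/-- Let p be the characteristic polynomial. If adj(μ - D) = 0, differentiating (X - D) adj(X - D) =
p(X) at μ gives (μ - D)K = p'(μ). Since μ - D is singular, taking determinants gives p'(μ) = 0, so μ
is a double root. -/
lemma nonderogatory_of_separable {D : Fin n → Fin n → ℂ} (h : (of D).charpoly.Separable) :
    Nonderogatory D := by
  intro μ hμ hadj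
  have hroot : (of D).charpoly.eval μ = 0 := by rw [eval_charpoly_eq_charDet, hμ]
  have hn : n ≠ 0 := by
    rintro rfl
    simp [charDet] at hμ
  have hadj' : ∀ i j, ((of D).charmatrix.adjugate i j).eval μ = 0 := by
    intro i j
    have h1 := (Polynomial.evalRingHom μ).map_adjugate (of D).charmatrix
    have h2 : (Polynomial.evalRingHom μ).mapMatrix (of D).charmatrix =
        μ • (1 : Matrix (Fin n) (Fin n) ℂ) - of D := by
      ext i j
      by_cases hij : i = j <;> simp [one_apply, hij]
    rw [h2, hadj] at h1
    exact congrFun (congrFun h1 i) j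
  have hmul := mul_adjugate (of D).charmatrix
  set K : Matrix (Fin n) (Fin n) ℂ := of fun i j =>
    (Polynomial.derivative ((of D).charmatrix.adjugate i j)).eval μ with hK
  have hentry : (μ • (1 : Matrix (Fin n) (Fin n) ℂ) - of D) * K =
      ((Polynomial.derivative (of D).charpoly).eval μ) • (1 : Matrix (Fin n) (Fin n) ℂ) := by
    ext i j
    have h1 := congrArg (fun p => (Polynomial.derivative p).eval μ) (congrFun (congrFun hmul i) j)
    simp only [mul_apply, Polynomial.derivative_sum, Polynomial.eval_finsetSum,
      Polynomial.derivative_mul, Polynomial.eval_add, Polynomial.eval_mul, hadj', mul_zero,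
      zero_add] at h1
    rw [mul_apply]
    refine Eq.trans (Finset.sum_congr rfl fun k _ => ?_) (h1.trans ?_)
    · congr 1
      by_cases hik : i = k <;> simp [one_apply, hik]
    · by_cases hij : i = j <;> simp [one_apply, hij, charpoly]
  have hdet := congrArg det hentry
  rw [det_mul, det_smul, det_one, mul_one, Fintype.card_fin] at hdet
  change charDet μ D * _ = _ at hdet
  rw [hμ, zero_mul] at hdet
  have hd : (Polynomial.derivative (of D).charpoly).eval μ = 0 := by
    exact (pow_eq_zero_iff hn).1 hdet.symm
  obtain ⟨u, v, huv⟩ := h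
  have := congrArg (Polynomial.eval μ) huv
  simp [hroot, hd] at this

lemma continuous_charDet (A : Fin n → Fin n → ℂ) : Continuous fun x => charDet x A := by
  unfold charDet
  exact Continuous.matrix_det (by fun_prop)

/-- The Schur complement formula holds off the finite spectrum of D, and both sides are continuous
in x. -/
lemma charDet_blk_eq (x a : ℂ) (w c : Fin n → ℂ) (D : Fin n → Fin n → ℂ) :
    charDet x (blk a w c D) = (x - a) * charDet x D - w ⬝ᵥ adjVec x D c := by
  have hfin : {x | (of D).charpoly.IsRoot x}.Finite :=
    Polynomial.finite_setOfPred_isRoot (charpoly_monic _).ne_zero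
  have hadj : Continuous fun x => w ⬝ᵥ adjVec x D c := by
    unfold adjVec
    have : Continuous fun x : ℂ => (x • (1 : Matrix (Fin n) (Fin n) ℂ) - of D).adjugate :=
      Continuous.matrix_adjugate (by fun_prop)
    exact Continuous.dotProduct continuous_const (this.matrix_mulVec continuous_const)
  have hd := continuous_charDet D
  refine congrFun (Continuous.ext_on (f := fun x => charDet x (blk a w c D))
    (g := fun x => (x - a) * charDet x D - w ⬝ᵥ adjVec x D c) (hfin.countable.dense_compl ℂ)
    (continuous_charDet _) (by fun_prop) fun y hy => ?_) x
  have hy0 : charDet y D ≠ 0 := by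
    rw [← eval_charpoly_eq_charDet]
    exact hy
  simp only [charDet_blk_of_ne_zero hy0]
  field_simp

/-- Dependence on the corner is affine. So the eigenvalues of the block matrix are the roots of P -
aQ, to which the facts about the fibres of P / Q apply. -/
lemma charpoly_blk (a : ℂ) (w c : Fin n → ℂ) (D : Fin n → Fin n → ℂ) :
    (of (blk a w c D)).charpoly =
      (of (blk 0 w c D)).charpoly - Polynomial.C a * (of D).charpoly := by
  refine Polynomial.funext fun x => ?_
  simp only [Polynomial.eval_sub, Polynomial.eval_mul, Polynomial.eval_C,
    eval_charpoly_eq_charDet, charDet_blk_eq]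
  ring

lemma ae_linearMap_ne_zero {M : Type*} [AddCommGroup M] [Module ℂ M]
    (f : (Fin n → ℂ) →ₗ[ℂ] M) (hf : f ≠ 0) : ∀ᵐ v : Fin n → ℂ, f v ≠ 0 := by
  have h : (volume : Measure (Fin n → ℂ)) ((LinearMap.ker f).restrictScalars ℝ : Submodule ℝ _) =
      0 := by
    refine Measure.addHaar_submodule volume _ fun htop => hf ?_
    rw [Submodule.restrictScalars_eq_top_iff] at htop
    exact LinearMap.ker_eq_top.1 htop
  rw [ae_iff]
  convert h using 2
  ext v
  simp

/-- At an eigenvalue μ of D the other polynomial equals -w adj(μ - D) c. For nonderogatory D this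
bilinear form is nonzero, so it vanishes only on null sets of w, and then of c. There are finitely
many μ. -/
lemma ae_coprime_charpoly_blk {D : Fin n → Fin n → ℂ} (hD : Nonderogatory D) :
    ∀ᵐ w : Fin n → ℂ, ∀ᵐ c : Fin n → ℂ,
      IsCoprime (of (blk 0 w c D)).charpoly (of D).charpoly := by
  have hmem : ∀ μ, μ ∈ (of D).charpoly.roots.toFinset ↔ charDet μ D = 0 := by
    intro μ
    rw [Multiset.mem_toFinset, Polynomial.mem_roots (charpoly_monic _).ne_zero,
      Polynomial.IsRoot, eval_charpoly_eq_charDet]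
  have hw : ∀ᵐ w : Fin n → ℂ, ∀ μ ∈ (of D).charpoly.roots.toFinset,
      w ᵥ* (μ • (1 : Matrix (Fin n) (Fin n) ℂ) - of D).adjugate ≠ 0 := by
    refine (Filter.eventually_all_finset _).2 fun μ hμ => ?_
    refine ae_linearMap_ne_zero (vecMulLinear _) fun h => hD μ ((hmem μ).1 hμ) ?_
    ext i j
    have := congrFun (LinearMap.congr_fun h (Pi.single i 1)) j
    simpa using this
  filter_upwards [hw] with w hw
  have hc : ∀ᵐ c : Fin n → ℂ, ∀ μ ∈ (of D).charpoly.roots.toFinset,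
      (w ᵥ* (μ • (1 : Matrix (Fin n) (Fin n) ℂ) - of D).adjugate) ⬝ᵥ c ≠ 0 := by
    refine (Filter.eventually_all_finset _).2 fun μ hμ => ?_
    refine ae_linearMap_ne_zero (dotProductBilin ℂ ℂ
      (w ᵥ* (μ • (1 : Matrix (Fin n) (Fin n) ℂ) - of D).adjugate)) fun h => hw μ hμ ?_
    ext i
    have := LinearMap.congr_fun h (Pi.single i 1)
    simpa using this
  filter_upwards [hc] with c hc
  rw [Polynomial.isCoprime_iff_aeval_ne_zero_of_isAlgClosed ℂ ℂ]
  intro μ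
  simp only [Polynomial.coe_aeval_eq_eval, eval_charpoly_eq_charDet]
  by_cases hμ : charDet μ D = 0
  · left
    rw [charDet_blk_eq, hμ, mul_zero, zero_sub, neg_ne_zero, adjVec, dotProduct_mulVec]
    exact hc μ ((hmem μ).2 hμ)
  · exact Or.inr hμ

lemma degree_charpoly_lt (w c : Fin n → ℂ) (D : Fin n → Fin n → ℂ) :
    (of D).charpoly.degree < (of (blk 0 w c D)).charpoly.degree := by
  rw [charpoly_degree_eq_dim, charpoly_degree_eq_dim]
  simp only [Fintype.card_fin]
  exact_mod_cast n.lt_succ_self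

lemma natDegree_charpoly_blk (w c : Fin n → ℂ) (D : Fin n → Fin n → ℂ) :
    (of (blk 0 w c D)).charpoly.natDegree = n + 1 := by
  rw [charpoly_natDegree_eq_dim, Fintype.card_fin]

/-- Induction on the size. For generic D, w, c the polynomial P - aQ has simple roots for almost
every corner a, and a separable characteristic polynomial excludes derogatory matrices. -/
theorem ae_nonderogatory : ∀ n : ℕ, ∀ᵐ D : Fin n → Fin n → ℂ, Nonderogatory D := by
  intro n
  induction n with
  | zero =>
    refine ae_of_all _ fun D μ hμ => ?_
    simp [charDet] at hμ
  | succ n ih =>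
    rw [ae_iff]
    set bad := {A : Fin (n + 1) → Fin (n + 1) → ℂ | ¬ Nonderogatory A} with hbad
    have hm : MeasurableSet bad := measurableSet_nonderogatory.compl
    rw [← lintegral_indicator_one hm, lintegral_blk _ (measurable_one.indicator hm)]
    refine (lintegral_congr_ae ?_).trans lintegral_zero
    filter_upwards [ih] with D hD
    refine (lintegral_congr_ae ?_).trans lintegral_zero
    filter_upwards [ae_coprime_charpoly_blk hD] with w hw
    refine (lintegral_congr_ae ?_).trans lintegral_zero
    filter_upwards [hw] with c hc
    refine (lintegral_congr_ae ?_).trans lintegral_zero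
    filter_upwards [ae_nodup_roots_sub_C_mul (charpoly_monic _) (degree_charpoly_lt w c D)
      (by rw [natDegree_charpoly_blk]; omega) hc] with a ha
    refine Set.indicator_of_notMem ?_ _
    simp only [hbad, Set.mem_ofPred_eq, not_not]
    refine nonderogatory_of_separable ?_
    rw [← charpoly_blk] at ha
    exact (Polynomial.nodup_roots_iff_of_splits (charpoly_monic _).ne_zero
      (IsAlgClosed.splits _)).1 ha

end BlockMeasure

/-! ### From matrix entries to eigenvalue, eigenvector and quotient. -/

section ChangeOfVariables

open Matrix
open scoped ENNReal Topology

variable {n : ℕ}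

lemma continuous_sub_of : Continuous fun p : ℂ × (Fin n → Fin n → ℂ) =>
    p.1 • (1 : Matrix (Fin n) (Fin n) ℂ) - of p.2 := by
  have h1 : Continuous fun p : ℂ × (Fin n → Fin n → ℂ) => (of p.2 : Matrix (Fin n) (Fin n) ℂ) :=
    continuous_snd
  fun_prop

lemma continuous_charDet_prod :
    Continuous fun p : ℂ × (Fin n → Fin n → ℂ) => charDet p.1 p.2 :=
  continuous_sub_of.matrix_det

lemma continuous_adjVec_prod : Continuous fun p : (ℂ × (Fin n → Fin n → ℂ)) × (Fin n → ℂ) =>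
    adjVec p.1.1 p.1.2 p.2 :=
  ((continuous_sub_of.comp continuous_fst).matrix_adjugate).matrix_mulVec continuous_snd

lemma inv_mulVec_eq (x : ℂ) (D : Fin n → Fin n → ℂ) (v : Fin n → ℂ) :
    (x • (1 : Matrix (Fin n) (Fin n) ℂ) - of D)⁻¹ *ᵥ v = (charDet x D)⁻¹ • adjVec x D v := by
  rw [inv_eq_smul_adjugate, ← charDet, adjVec, smul_mulVec]

/-- The eigenvalue equation of `blk a w c D` solved for `a`. -/
noncomputable def corner (w c : Fin n → ℂ) (D : Fin n → Fin n → ℂ) (x : ℂ) : ℂ :=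
  x - (w ⬝ᵥ adjVec x D c) / charDet x D

/-- The derivative of `corner`. -/
noncomputable def cornerDeriv (w c : Fin n → ℂ) (D : Fin n → Fin n → ℂ) (x : ℂ) : ℂ :=
  1 + (w ⬝ᵥ adjVec x D (adjVec x D c)) / charDet x D ^ 2

lemma resolvent_sub {x y : ℂ} {D : Fin n → Fin n → ℂ} (hx : charDet x D ≠ 0)
    (hy : charDet y D ≠ 0) (c : Fin n → ℂ) :
    (charDet y D)⁻¹ • adjVec y D c - (charDet x D)⁻¹ • adjVec x D c =
      -((y - x) • ((charDet y D)⁻¹ • adjVec y D ((charDet x D)⁻¹ • adjVec x D c))) := by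
  have hux : IsUnit (x • (1 : Matrix (Fin n) (Fin n) ℂ) - of D).det := isUnit_iff_ne_zero.2 hx
  have huy : IsUnit (y • (1 : Matrix (Fin n) (Fin n) ℂ) - of D).det := isUnit_iff_ne_zero.2 hy
  simp only [← inv_mulVec_eq]
  set X := x • (1 : Matrix (Fin n) (Fin n) ℂ) - of D with hX
  set Y := y • (1 : Matrix (Fin n) (Fin n) ℂ) - of D with hY
  have hXY : Y⁻¹ - X⁻¹ = -((y - x) • (Y⁻¹ * X⁻¹)) := by
    have h1 : Y⁻¹ * (X - Y) * X⁻¹ = Y⁻¹ - X⁻¹ := by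
      rw [Matrix.mul_sub, Matrix.sub_mul, nonsing_inv_mul Y huy, Matrix.one_mul, Matrix.mul_assoc,
        mul_nonsing_inv X hux, Matrix.mul_one]
    have h2 : X - Y = -((y - x) • (1 : Matrix (Fin n) (Fin n) ℂ)) := by
      rw [hX, hY, sub_smul]
      abel
    rw [← h1, h2]
    simp
  rw [← sub_mulVec, hXY, neg_mulVec, smul_mulVec, mulVec_mulVec]

/-- By the resolvent identity, the difference quotient at y equals 1 + w (y - D)⁻¹(x - D)⁻¹ c, which
extends continuously to y = x. -/
lemma hasDerivAt_corner {x : ℂ} {D : Fin n → Fin n → ℂ} (hx : charDet x D ≠ 0)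
    (w c : Fin n → ℂ) : HasDerivAt (corner w c D) (cornerDeriv w c D x) x := by
  rw [hasDerivAt_iff_tendsto_slope]
  set u := (charDet x D)⁻¹ • adjVec x D c with hu
  have hcont : ContinuousAt (fun y => 1 + w ⬝ᵥ ((charDet y D)⁻¹ • adjVec y D u)) x := by
    have h1 : Continuous fun y => adjVec y D u :=
      continuous_adjVec_prod.comp (f := fun y : ℂ => ((y, D), u)) (by fun_prop)
    have h2 : ContinuousAt (fun y => (charDet y D)⁻¹) x :=
      (continuous_charDet D).continuousAt.inv₀ hx
    have h3 : ContinuousAt (fun y => (charDet y D)⁻¹ * (w ⬝ᵥ adjVec y D u)) x :=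
      h2.mul (continuous_const.dotProduct h1).continuousAt
    simp only [dotProduct_smul, smul_eq_mul]
    exact continuousAt_const.add h3
  have hval : 1 + w ⬝ᵥ ((charDet x D)⁻¹ • adjVec x D u) = cornerDeriv w c D x := by
    rw [cornerDeriv, hu, adjVec, mulVec_smul, dotProduct_smul, dotProduct_smul, ← adjVec]
    simp only [smul_eq_mul]
    field_simp
  rw [← hval]
  refine (hcont.tendsto.mono_left nhdsWithin_le_nhds).congr' ?_
  have hne : ∀ᶠ y in 𝓝[≠] x, charDet y D ≠ 0 :=
    ((continuous_charDet D).continuousAt.eventually_ne hx).filter_mono nhdsWithin_le_nhds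
  filter_upwards [hne, self_mem_nhdsWithin] with y hy hyx
  have hyx' : y - x ≠ 0 := sub_ne_zero.2 hyx
  have hr := congrArg (fun v => w ⬝ᵥ v) (resolvent_sub hx hy c)
  simp only [dotProduct_sub, dotProduct_neg, dotProduct_smul, smul_eq_mul, ← hu] at hr
  rw [slope_def_field, eq_div_iff hyx', corner, corner, dotProduct_smul, smul_eq_mul,
    div_eq_inv_mul, div_eq_inv_mul]
  rw [hu, dotProduct_smul, smul_eq_mul, ← hu] at hr
  linear_combination hr

/-- Area formula for the map `x ↦ corner w c D x`. -/
lemma lintegral_corner {w c : Fin n → ℂ} {D : Fin n → Fin n → ℂ}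
    (hcop : IsCoprime (of (blk 0 w c D)).charpoly (of D).charpoly) (h : ℂ → ℝ≥0∞)
    (hh : Measurable h) :
    ((n + 1 : ℕ) : ℝ≥0∞) * ∫⁻ a, h a =
      ∫⁻ x, ENNReal.ofReal (‖cornerDeriv w c D x‖ ^ 2) * h (corner w c D x) := by
  have hkey := lintegral_comp_div_mul_deriv_sq (charpoly_monic _) (degree_charpoly_lt w c D)
    (by rw [natDegree_charpoly_blk]; omega) (charpoly_monic _).ne_zero hcop h hh
  rw [natDegree_charpoly_blk] at hkey
  rw [← hkey]
  have hfin : {x | (of D).charpoly.IsRoot x}.Finite :=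
    Polynomial.finite_setOfPred_isRoot (charpoly_monic _).ne_zero
  refine lintegral_congr_ae ?_
  filter_upwards [compl_mem_ae_iff.2 (hfin.measure_zero volume)] with x hx
  have hx0 : (of D).charpoly.eval x ≠ 0 := hx
  have hdiv : ∀ y, charDet y D ≠ 0 →
      (of (blk 0 w c D)).charpoly.eval y / (of D).charpoly.eval y = corner w c D y := by
    intro y hy
    rw [eval_charpoly_eq_charDet, eval_charpoly_eq_charDet, charDet_blk_of_ne_zero hy, corner]
    field_simp
    ring
  have hx1 : charDet x D ≠ 0 := by rwa [← eval_charpoly_eq_charDet]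
  have hd := ((of (blk 0 w c D)).charpoly.hasDerivAt x).div ((of D).charpoly.hasDerivAt x) hx0
  have hev : (fun y => (of (blk 0 w c D)).charpoly.eval y / (of D).charpoly.eval y) =ᶠ[𝓝 x]
      corner w c D :=
    ((continuous_charDet D).continuousAt.eventually_ne hx1).mono hdiv
  have hd' := (hasDerivAt_corner hx1 w c).congr_of_eventuallyEq hev
  -- Near x the quotient P / Q coincides with `corner`, so uniqueness of the derivative identifies
  -- the two Jacobians.
  have heq := hd.unique hd'
  rw [hdiv x hx1, ← heq]
  simp only [Polynomial.eval_sub, Polynomial.eval_mul]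

lemma lintegral_comp_linearMap {E : Type*} [NormedAddCommGroup E] [NormedSpace ℝ E]
    [MeasurableSpace E] [BorelSpace E] [FiniteDimensional ℝ E] (μ : Measure E)
    [μ.IsAddHaarMeasure] {f : E →ₗ[ℝ] E} (hf : LinearMap.det f ≠ 0) (h : E → ℝ≥0∞)
    (hh : Measurable h) :
    ∫⁻ v, h (f v) ∂μ = ENNReal.ofReal |(LinearMap.det f)⁻¹| * ∫⁻ v, h v ∂μ := by
  have hm : Measurable f := f.continuous_of_finiteDimensional.measurable
  rw [← lintegral_map hh hm, Measure.map_linearMap_addHaar_eq_smul_addHaar μ hf,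
    lintegral_smul_measure, smul_eq_mul]

lemma lintegral_mulVec {M : Matrix (Fin n) (Fin n) ℂ} (hM : M.det ≠ 0)
    (h : (Fin n → ℂ) → ℝ≥0∞) (hh : Measurable h) :
    ∫⁻ c, h c = ENNReal.ofReal (‖M.det‖ ^ 2) * ∫⁻ q, h (M *ᵥ q) := by
  have habs := abs_det_restrictScalars (toLin' M)
  rw [LinearMap.det_toLin'] at habs
  have hpos : 0 < ‖M.det‖ ^ 2 := by have := norm_pos_iff.2 hM; positivity
  have hdet : LinearMap.det ((toLin' M).restrictScalars ℝ) ≠ 0 := by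
    rw [← abs_pos, habs]
    exact hpos
  have key := lintegral_comp_linearMap volume hdet h hh
  rw [abs_inv, habs] at key
  change ∫⁻ q, h (M *ᵥ q) = _ at key
  rw [key, ← mul_assoc, ← ENNReal.ofReal_mul hpos.le, mul_inv_cancel₀ hpos.ne', ENNReal.ofReal_one,
    one_mul]

lemma lintegral_four_swap {A B C E : Type*} [MeasureSpace A] [MeasureSpace B] [MeasureSpace C]
    [MeasureSpace E] [SigmaFinite (volume : Measure A)] [SigmaFinite (volume : Measure B)]
    [SigmaFinite (volume : Measure C)] [SigmaFinite (volume : Measure E)]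
    (f : A → B → C → E → ℝ≥0∞)
    (hf : Measurable fun p : (A × B) × C × E => f p.1.1 p.1.2 p.2.1 p.2.2) :
    ∫⁻ a, ∫⁻ b, ∫⁻ c, ∫⁻ e, f a b c e = ∫⁻ c, ∫⁻ e, ∫⁻ b, ∫⁻ a, f a b c e := by
  have h1 : ∀ a b, ∫⁻ c, ∫⁻ e, f a b c e = ∫⁻ q : C × E, f a b q.1 q.2 := fun a b =>
    (lintegral_prod (fun q : C × E => f a b q.1 q.2)
      (hf.comp (f := fun q : C × E => ((a, b), q)) (by fun_prop)).aemeasurable).symm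
  have h2 : ∀ c e, ∫⁻ b, ∫⁻ a, f a b c e = ∫⁻ p : A × B, f p.1 p.2 c e := fun c e =>
    (lintegral_prod_symm (fun p : A × B => f p.1 p.2 c e)
      (hf.comp (f := fun p : A × B => (p, (c, e))) (by fun_prop)).aemeasurable).symm
  simp_rw [h1, h2]
  rw [← lintegral_prod (fun p : A × B => ∫⁻ q : C × E, f p.1 p.2 q.1 q.2)
    hf.lintegral_prod_right'.aemeasurable,
    ← lintegral_prod (fun q : C × E => ∫⁻ p : A × B, f p.1 p.2 q.1 q.2)
    hf.lintegral_prod_left'.aemeasurable]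
  exact lintegral_lintegral_swap hf.aemeasurable

lemma rankOneAdd_neg_rankOneAdd (q w : Fin n → ℂ) (B : Fin n → Fin n → ℂ) :
    rankOneAdd (-q) w (rankOneAdd q w B) = B := by
  ext i j
  simp [rankOneAdd]

lemma measurable_blk_comp {α : Type*} [MeasurableSpace α] {a : α → ℂ} {w c : α → Fin n → ℂ}
    {D : α → Fin n → Fin n → ℂ} (ha : Measurable a) (hw : Measurable w) (hc : Measurable c)
    (hD : Measurable D) : Measurable fun x => blk (a x) (w x) (c x) (D x) :=
  measurable_blk.comp ((ha.prodMk hw).prodMk (hc.prodMk hD))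

lemma measurable_charDet_comp {α : Type*} [MeasurableSpace α] {a : α → ℂ}
    {D : α → Fin n → Fin n → ℂ} (ha : Measurable a) (hD : Measurable D) :
    Measurable fun x => charDet (a x) (D x) :=
  continuous_charDet_prod.measurable.comp (ha.prodMk hD)

lemma measurable_dotProduct_comp {α : Type*} [MeasurableSpace α] {v w : α → Fin n → ℂ}
    (hv : Measurable v) (hw : Measurable w) : Measurable fun x => v x ⬝ᵥ w x := by
  unfold dotProduct
  exact Finset.measurable_fun_sum _ fun i _ =>
    (measurable_pi_iff.1 hv i).mul (measurable_pi_iff.1 hw i)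

lemma measurable_mulVec_comp {α : Type*} [MeasurableSpace α] {D : α → Fin n → Fin n → ℂ}
    {v : α → Fin n → ℂ} (hD : Measurable D) (hv : Measurable v) :
    Measurable fun x => (of (D x)) *ᵥ v x :=
  measurable_pi_iff.2 fun i => measurable_dotProduct_comp (measurable_pi_iff.1 hD i) hv

lemma measurable_adjVec_comp {α : Type*} [MeasurableSpace α] {a : α → ℂ}
    {D : α → Fin n → Fin n → ℂ} {v : α → Fin n → ℂ} (ha : Measurable a) (hD : Measurable D)
    (hv : Measurable v) : Measurable fun x => adjVec (a x) (D x) (v x) := by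
  have h : Continuous fun p : ℂ × (Fin n → Fin n → ℂ) => fun i j =>
      (p.1 • (1 : Matrix (Fin n) (Fin n) ℂ) - of p.2).adjugate i j :=
    continuous_sub_of.matrix_adjugate
  have h2 := h.measurable.comp (ha.prodMk hD)
  exact measurable_mulVec_comp h2 hv

lemma measurable_rankOneAdd_comp {α : Type*} [MeasurableSpace α] {q w : α → Fin n → ℂ}
    {B : α → Fin n → Fin n → ℂ} (hq : Measurable q) (hw : Measurable w) (hB : Measurable B) :
    Measurable fun x => rankOneAdd (q x) (w x) (B x) := by
  unfold rankOneAdd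
  fun_prop

lemma measurable_eigBlk_comp {α : Type*} [MeasurableSpace α] {a : α → ℂ} {q w : α → Fin n → ℂ}
    {B : α → Fin n → Fin n → ℂ} (ha : Measurable a) (hq : Measurable q) (hw : Measurable w)
    (hB : Measurable B) : Measurable fun x => eigBlk (a x) (q x) (w x) (B x) := by
  have hr := measurable_rankOneAdd_comp hq hw hB
  exact measurable_blk_comp (ha.sub (measurable_dotProduct_comp hw hq)) hw
    ((ha.smul hq).sub (measurable_mulVec_comp hr hq)) hr

/-- Integration over matrices, disintegrated along an eigenvalue, an eigenvector and a quotient.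
Every matrix is counted once for each of its `n + 1` eigenvalues. -/
theorem lintegral_eigBlk (F : (Fin (n + 1) → Fin (n + 1) → ℂ) → ℝ≥0∞) (hF : Measurable F) :
    ((n + 1 : ℕ) : ℝ≥0∞) * ∫⁻ A, F A =
      ∫⁻ x : ℂ, ∫⁻ q : Fin n → ℂ, ∫⁻ w : Fin n → ℂ, ∫⁻ B : Fin n → Fin n → ℂ,
        ENNReal.ofReal (‖charDet x B‖ ^ 2) * F (eigBlk x q w B) := by
  set Ψ : (Fin n → Fin n → ℂ) → (Fin n → ℂ) → ℂ → (Fin n → ℂ) → ℝ≥0∞ := fun D w x q =>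
    ENNReal.ofReal (‖charDet x (rankOneAdd (-q) w D)‖ ^ 2) *
      F (blk (x - w ⬝ᵥ q) w (x • q - of D *ᵥ q) D) with hΨ
  have hΨm : Measurable fun p : ((Fin n → Fin n → ℂ) × (Fin n → ℂ)) × ℂ × (Fin n → ℂ) =>
      Ψ p.1.1 p.1.2 p.2.1 p.2.2 := by
    have h1 := measurable_charDet_comp
      (a := fun p : ((Fin n → Fin n → ℂ) × (Fin n → ℂ)) × ℂ × (Fin n → ℂ) => p.2.1)
      (D := fun p => rankOneAdd (-p.2.2) p.1.2 p.1.1) (by fun_prop)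
      (measurable_rankOneAdd_comp (by fun_prop) (by fun_prop) (by fun_prop))
    have h2 := measurable_blk_comp
      (a := fun p : ((Fin n → Fin n → ℂ) × (Fin n → ℂ)) × ℂ × (Fin n → ℂ) =>
        p.2.1 - p.1.2 ⬝ᵥ p.2.2) (w := fun p => p.1.2)
      (c := fun p => p.2.1 • p.2.2 - of p.1.1 *ᵥ p.2.2) (D := fun p => p.1.1)
      (measurable_snd.fst.sub (measurable_dotProduct_comp (by fun_prop) (by fun_prop)))
      (by fun_prop)
      ((measurable_snd.fst.smul measurable_snd.snd).sub
        (measurable_mulVec_comp (by fun_prop) (by fun_prop))) (by fun_prop)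
    exact (h1.norm.pow_const 2).ennreal_ofReal.mul (hF.comp h2)
  have hstep : ∀ᵐ D : Fin n → Fin n → ℂ, ∀ᵐ w : Fin n → ℂ,
      ((n + 1 : ℕ) : ℝ≥0∞) * ∫⁻ c : Fin n → ℂ, ∫⁻ a : ℂ, F (blk a w c D) =
        ∫⁻ x, ∫⁻ q, Ψ D w x q := by
    filter_upwards [ae_nonderogatory n] with D hD
    filter_upwards [ae_coprime_charpoly_blk hD] with w hw
    have hcm : Measurable fun p : (Fin n → ℂ) × ℂ =>
        ENNReal.ofReal (‖cornerDeriv w p.1 D p.2‖ ^ 2) * F (blk (corner w p.1 D p.2) w p.1 D) := by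
      have hdet := measurable_charDet_comp (a := fun p : (Fin n → ℂ) × ℂ => p.2)
        (D := fun _ => D) (by fun_prop) (by fun_prop)
      have had := measurable_adjVec_comp (a := fun p : (Fin n → ℂ) × ℂ => p.2)
        (D := fun _ => D) (v := fun p => p.1) (by fun_prop) (by fun_prop) (by fun_prop)
      have had2 := measurable_adjVec_comp (a := fun p : (Fin n → ℂ) × ℂ => p.2)
        (D := fun _ => D) (by fun_prop) (by fun_prop) had
      have hc : Measurable fun p : (Fin n → ℂ) × ℂ => corner w p.1 D p.2 :=
        measurable_snd.sub ((measurable_dotProduct_comp (measurable_const (a := w)) had).div hdet)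
      have hc' : Measurable fun p : (Fin n → ℂ) × ℂ => cornerDeriv w p.1 D p.2 :=
        measurable_const.add
          ((measurable_dotProduct_comp (measurable_const (a := w)) had2).div (hdet.pow_const 2))
      exact (hc'.norm.pow_const 2).ennreal_ofReal.mul
        (hF.comp (measurable_blk_comp hc (by fun_prop) (by fun_prop) (by fun_prop)))
    have h1 : ((n + 1 : ℕ) : ℝ≥0∞) * ∫⁻ c : Fin n → ℂ, ∫⁻ a : ℂ, F (blk a w c D) =
        ∫⁻ c : Fin n → ℂ, ∫⁻ x, ENNReal.ofReal (‖cornerDeriv w c D x‖ ^ 2) *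
          F (blk (corner w c D x) w c D) := by
      rw [← lintegral_const_mul' _ _ (ENNReal.natCast_ne_top _)]
      refine lintegral_congr_ae ?_
      filter_upwards [hw] with c hc
      exact lintegral_corner hc (fun a => F (blk a w c D)) (hF.comp (measurable_blk_comp
        (by fun_prop) (by fun_prop) (by fun_prop) (by fun_prop)))
    rw [h1, lintegral_lintegral_swap hcm.aemeasurable]
    have hfin : {x | (of D).charpoly.IsRoot x}.Finite :=
      Polynomial.finite_setOfPred_isRoot (charpoly_monic _).ne_zero
    refine lintegral_congr_ae ?_
    filter_upwards [compl_mem_ae_iff.2 (hfin.measure_zero volume)] with x hx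
    have hx1 : charDet x D ≠ 0 := by rw [← eval_charpoly_eq_charDet]; exact hx
    -- Substitute c = (x - D)q, so that (1, q) becomes an eigenvector for x; the Jacobian is |det(x
    -- - D)|².
    rw [lintegral_mulVec (M := x • (1 : Matrix (Fin n) (Fin n) ℂ) - of D) hx1
      (fun c => ENNReal.ofReal (‖cornerDeriv w c D x‖ ^ 2) * F (blk (corner w c D x) w c D))
      (hcm.comp (f := fun c : Fin n → ℂ => (c, x)) (by fun_prop)),
      ← lintegral_const_mul' _ _ ENNReal.ofReal_ne_top]
    refine lintegral_congr fun q => ?_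
    have hadj : adjVec x D ((x • (1 : Matrix (Fin n) (Fin n) ℂ) - of D) *ᵥ q) =
        charDet x D • q := by
      rw [adjVec, mulVec_mulVec, adjugate_mul, smul_mulVec, one_mulVec]
      rfl
    have hcor : corner w ((x • (1 : Matrix (Fin n) (Fin n) ℂ) - of D) *ᵥ q) D x =
        x - w ⬝ᵥ q := by
      rw [corner, hadj, dotProduct_smul, smul_eq_mul, mul_div_cancel_left₀ _ hx1]
    -- The product of the two Jacobian factors is the characteristic polynomial of D - q ⊗ w at x,
    -- by the matrix determinant lemma.
    have hcor' : charDet x D *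
        cornerDeriv w ((x • (1 : Matrix (Fin n) (Fin n) ℂ) - of D) *ᵥ q) D x =
        charDet x (rankOneAdd (-q) w D) := by
      rw [charDet_add_rankOne hx1, cornerDeriv, hadj, adjVec, mulVec_smul, dotProduct_smul,
        ← adjVec, smul_eq_mul]
      field_simp
    rw [hΨ, hcor, ← mul_assoc, ← ENNReal.ofReal_mul (by positivity), ← mul_pow, ← charDet,
      ← norm_mul, hcor', sub_mulVec, smul_mulVec, one_mulVec]
  rw [lintegral_blk F hF, ← lintegral_const_mul' _ _ (ENNReal.natCast_ne_top _)]
  have hstep2 : ∫⁻ D : Fin n → Fin n → ℂ, ((n + 1 : ℕ) : ℝ≥0∞) *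
      ∫⁻ w : Fin n → ℂ, ∫⁻ c : Fin n → ℂ, ∫⁻ a : ℂ, F (blk a w c D) =
      ∫⁻ D, ∫⁻ w, ∫⁻ x, ∫⁻ q, Ψ D w x q := by
    refine lintegral_congr_ae ?_
    filter_upwards [hstep] with D hD
    rw [← lintegral_const_mul' _ _ (ENNReal.natCast_ne_top _)]
    exact lintegral_congr_ae hD
  rw [hstep2, lintegral_four_swap Ψ hΨm]
  refine lintegral_congr fun x => lintegral_congr fun q => lintegral_congr fun w => ?_
  -- Translation by q ⊗ w replaces D by the quotient B.
  rw [← lintegral_add_right_eq_self (fun D => Ψ D w x q) fun i j => q i * w j]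
  refine lintegral_congr fun B => ?_
  have hB : (B + fun i j => q i * w j) = rankOneAdd q w B := rfl
  rw [hB, hΨ]
  simp only [rankOneAdd_neg_rankOneAdd]
  rfl

end ChangeOfVariables

/-! ### The eigenvalue law of the Gaussian matrix, up to a constant. -/

section GinibreEigenvalues

open Matrix
open scoped ENNReal

variable {n : ℕ}

instance isAddHaarMeasure_volume_matrix :
    (volume : Measure (Fin n → Fin n → ℂ)).IsAddHaarMeasure :=
  Measure.pi.isAddHaarMeasure fun _ : Fin n => (volume : Measure (Fin n → ℂ))

/-- The unnormalised Gaussian density on matrices. -/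
noncomputable def gaussDensity (A : Fin n → Fin n → ℂ) : ℝ≥0∞ :=
  ENNReal.ofReal (Real.exp (-frobSq A))

lemma measurable_gaussDensity : Measurable (gaussDensity (n := n)) := by
  unfold gaussDensity frobSq
  fun_prop

lemma integrable_exp_neg_norm_sq : Integrable fun z : ℂ => Real.exp (-‖z‖ ^ 2) := by
  have h := integrable_norm_rpow_mul_exp (p := 2) (q := 0) (b := 1) (by norm_num) (by norm_num)
    (by norm_num)
  simpa using h

lemma exp_neg_frobSq (A : Fin n → Fin n → ℂ) :
    Real.exp (-frobSq A) = ∏ i, ∏ j, Real.exp (-‖A i j‖ ^ 2) := by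
  simp only [frobSq, ← Real.exp_sum, ← Finset.sum_neg_distrib]

lemma lintegral_gaussDensity_ne_top : ∫⁻ A, gaussDensity (n := n) A ≠ ∞ := by
  have h : Integrable fun A : Fin n → Fin n → ℂ => ∏ i, ∏ j, Real.exp (-‖A i j‖ ^ 2) :=
    Integrable.fintype_prod (f := fun _ (v : Fin n → ℂ) => ∏ j, Real.exp (-‖v j‖ ^ 2)) fun _ =>
      Integrable.fintype_prod (f := fun _ (z : ℂ) => Real.exp (-‖z‖ ^ 2)) fun _ =>
        integrable_exp_neg_norm_sq
  have h2 := h.lintegral_lt_top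
  simp_rw [← exp_neg_frobSq] at h2
  exact h2.ne

lemma lintegral_gaussDensity_ne_zero : ∫⁻ A, gaussDensity (n := n) A ≠ 0 := by
  intro h
  rw [lintegral_eq_zero_iff measurable_gaussDensity] at h
  obtain ⟨A, hA⟩ := h.exists
  simp only [gaussDensity, Pi.zero_apply, ENNReal.ofReal_eq_zero, not_le.2 (Real.exp_pos _)] at hA

/-- Conjugation by an invertible matrix, as a real-linear automorphism. -/
noncomputable def conjEquiv {S : Matrix (Fin n) (Fin n) ℂ} (hS : IsUnit S.det) :
    (Fin n → Fin n → ℂ) ≃ₗ[ℝ] (Fin n → Fin n → ℂ) where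
  toFun B := fun i j => (S * of B * S⁻¹) i j
  invFun B := fun i j => (S⁻¹ * of B * S) i j
  map_add' B B' := by
    have : of (B + B') = of B + of B' := rfl
    ext i j
    rw [this, Matrix.mul_add, Matrix.add_mul]
    rfl
  map_smul' r B := by
    have : of (r • B) = r • of B := rfl
    ext i j
    rw [this, Matrix.mul_smul, Matrix.smul_mul]
    rfl
  left_inv B := by
    change of.symm (S⁻¹ * (S * of B * S⁻¹) * S) = B
    rw [← Matrix.mul_assoc, ← Matrix.mul_assoc, nonsing_inv_mul S hS, Matrix.one_mul,
      Matrix.mul_assoc, nonsing_inv_mul S hS, Matrix.mul_one]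
    rfl
  right_inv B := by
    change of.symm (S * (S⁻¹ * of B * S) * S⁻¹) = B
    rw [← Matrix.mul_assoc, ← Matrix.mul_assoc, mul_nonsing_inv S hS, Matrix.one_mul,
      Matrix.mul_assoc, mul_nonsing_inv S hS, Matrix.mul_one]
    rfl

/-- The real-linear automorphism `w ↦ ρ w S⁻¹` of row vectors. -/
noncomputable def rowEquiv {S : Matrix (Fin n) (Fin n) ℂ} (hS : IsUnit S.det) {ρ : ℂ}
    (hρ : ρ ≠ 0) : (Fin n → ℂ) ≃ₗ[ℝ] (Fin n → ℂ) where
  toFun w := ρ • (w ᵥ* S⁻¹)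
  invFun w := ρ⁻¹ • (w ᵥ* S)
  map_add' w w' := by rw [add_vecMul, smul_add]
  map_smul' r w := by
    rw [smul_vecMul, smul_comm]
    rfl
  left_inv w := by
    simp only [smul_vecMul, vecMul_vecMul, nonsing_inv_mul S hS, vecMul_one, smul_smul,
      inv_mul_cancel₀ hρ, one_smul]
  right_inv w := by
    simp only [smul_vecMul, vecMul_vecMul, mul_nonsing_inv S hS, vecMul_one, smul_smul,
      mul_inv_cancel₀ hρ, one_smul]

lemma exists_lintegral_comp_linearEquiv {E : Type*} [NormedAddCommGroup E] [NormedSpace ℝ E]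
    [MeasurableSpace E] [BorelSpace E] [FiniteDimensional ℝ E] (μ : Measure E)
    [μ.IsAddHaarMeasure] (f : E ≃ₗ[ℝ] E) :
    ∃ k : ℝ≥0∞, k ≠ ∞ ∧ ∀ h : E → ℝ≥0∞, Measurable h → ∫⁻ v, h (f v) ∂μ = k * ∫⁻ v, h v ∂μ :=
  ⟨_, ENNReal.ofReal_ne_top, fun h hh =>
    lintegral_comp_linearMap μ (f := (f : E →ₗ[ℝ] E)) (LinearEquiv.isUnit_det' f).ne_zero h hh⟩

/-- Integrating out the first row of a matrix with prescribed eigenvector `(1, q)`. -/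
lemma exists_lintegral_gaussDensity_eigBlk (q : Fin n → ℂ) : ∃ κ : ℝ≥0∞, ∀ (x : ℂ)
    (G : (Fin n → Fin n → ℂ) → ℝ≥0∞), Measurable G →
    (∀ (S : Matrix (Fin n) (Fin n) ℂ) (hS : IsUnit S.det) B, G (conjEquiv hS B) = G B) →
    ∫⁻ w : Fin n → ℂ, ∫⁻ B, G B * gaussDensity (eigBlk x q w B) =
      κ * (ENNReal.ofReal (Real.exp (-‖x‖ ^ 2)) * ∫⁻ B, G B * gaussDensity B) := by
  obtain ⟨ρ, s, S, hρ, hS, hfr⟩ := exists_frobSq_eigBlk_eq q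
  obtain ⟨k₁, -, hk₁⟩ := exists_lintegral_comp_linearEquiv (volume : Measure (Fin n → ℂ))
    (rowEquiv hS hρ)
  obtain ⟨k₂, -, hk₂⟩ := exists_lintegral_comp_linearEquiv
    (volume : Measure (Fin n → Fin n → ℂ)) (conjEquiv hS)
  set g : (Fin n → ℂ) → ℝ≥0∞ := fun v => ENNReal.ofReal (Real.exp (-∑ j, ‖v j‖ ^ 2)) with hg
  have hgm : Measurable g := by fun_prop
  refine ⟨k₂ * (k₁ * ∫⁻ v, g v), fun x G hG hconj => ?_⟩
  -- All dependence on w sits in `g`, at an argument shifted by a vector depending on x and B.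
  -- Translation invariance removes this shift, so the resulting constant depends on q alone.
  have hpt : ∀ w B, G B * gaussDensity (eigBlk x q w B) =
      (ENNReal.ofReal (Real.exp (-‖x‖ ^ 2)) * (G (conjEquiv hS B) * gaussDensity (conjEquiv hS B)))
        * g (rowEquiv hS hρ w + (s ᵥ* of B - x • s) ᵥ* S⁻¹) := by
    intro w B
    have e1 : rowEquiv hS hρ w + (s ᵥ* of B - x • s) ᵥ* S⁻¹ =
        (ρ • w + (s ᵥ* of B - x • s)) ᵥ* S⁻¹ := by
      rw [add_vecMul, smul_vecMul]
      rfl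
    rw [hconj, e1, gaussDensity, hfr, gaussDensity, hg]
    change _ = ENNReal.ofReal (Real.exp (-‖x‖ ^ 2)) * (G B * ENNReal.ofReal (Real.exp
      (-frobSq fun i j => (S * of B * S⁻¹) i j))) * _
    rw [neg_add, neg_add, Real.exp_add, Real.exp_add, ENNReal.ofReal_mul (by positivity),
      ENNReal.ofReal_mul (by positivity)]
    ring
  have hm : Measurable fun p : (Fin n → ℂ) × (Fin n → Fin n → ℂ) =>
      G p.2 * gaussDensity (eigBlk x q p.1 p.2) :=
    (hG.comp measurable_snd).mul (measurable_gaussDensity.comp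
      (measurable_eigBlk_comp (by fun_prop) (by fun_prop) (by fun_prop) (by fun_prop)))
  have hrow : ∀ B : Fin n → Fin n → ℂ, ∫⁻ w, G B * gaussDensity (eigBlk x q w B) =
      (ENNReal.ofReal (Real.exp (-‖x‖ ^ 2)) * (G (conjEquiv hS B) * gaussDensity (conjEquiv hS B)))
        * (k₁ * ∫⁻ v, g v) := by
    intro B
    simp_rw [hpt]
    have hgm' : Measurable fun v => g (v + (s ᵥ* of B - x • s) ᵥ* S⁻¹) :=
      hgm.comp (measurable_id.add_const _)
    have hgm'' : Measurable fun w => g (rowEquiv hS hρ w + (s ᵥ* of B - x • s) ᵥ* S⁻¹) :=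
      hgm'.comp ((rowEquiv hS hρ : (Fin n → ℂ) →ₗ[ℝ] (Fin n → ℂ)).continuous_of_finiteDimensional
        |>.measurable)
    rw [lintegral_const_mul _ hgm'', hk₁ (fun v => g (v + (s ᵥ* of B - x • s) ᵥ* S⁻¹)) hgm',
      lintegral_add_right_eq_self g]
  have hGg : Measurable fun B => G B * gaussDensity B := hG.mul measurable_gaussDensity
  have hGg' : Measurable fun B => G (conjEquiv hS B) * gaussDensity (conjEquiv hS B) :=
    hGg.comp (f := conjEquiv hS) (LinearMap.continuous_of_finiteDimensional
      (conjEquiv hS : (Fin n → Fin n → ℂ) →ₗ[ℝ] (Fin n → Fin n → ℂ))).measurable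
  rw [lintegral_lintegral_swap hm.aemeasurable]
  simp_rw [hrow]
  rw [lintegral_mul_const _ (hGg'.const_mul _), lintegral_const_mul _ hGg',
    hk₂ (fun B => G B * gaussDensity B) hGg]
  ring

/-- The function `u ↦ ∏ ‖z - u‖ ^ γ` over a list of pairs `(z, γ)`. -/
noncomputable def listWeight (l : List (ℂ × ℝ)) (u : ℂ) : ℝ :=
  (l.map fun p => ‖p.1 - u‖ ^ p.2).prod

/-- The function `A ↦ ∏ |det (z - A)| ^ γ` over a list of pairs `(z, γ)`. -/
noncomputable def listDet (l : List (ℂ × ℝ)) (A : Fin n → Fin n → ℂ) : ℝ :=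
  (l.map fun p => ‖charDet p.1 A‖ ^ p.2).prod

/-- The candidate joint eigenvalue density, weighted by `listWeight l`. -/
noncomputable def listJoint (l : List (ℂ × ℝ)) (u : Fin n → ℂ) : ℝ :=
  (∏ i, listWeight l (u i) * Real.exp (-‖u i‖ ^ 2)) * ∏ i, ∏ j ∈ Finset.Ioi i, ‖u j - u i‖ ^ 2

lemma listWeight_nonneg (l : List (ℂ × ℝ)) (u : ℂ) : 0 ≤ listWeight l u := by
  refine List.prod_nonneg fun a ha => ?_
  obtain ⟨p, -, rfl⟩ := List.mem_map.1 ha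
  positivity

lemma listDet_cons_two (x : ℂ) (l : List (ℂ × ℝ)) (A : Fin n → Fin n → ℂ) :
    listDet ((x, 2) :: l) A = ‖charDet x A‖ ^ 2 * listDet l A := by
  simp [listDet]

lemma listWeight_cons_two (x : ℂ) (l : List (ℂ × ℝ)) (u : ℂ) :
    listWeight ((x, 2) :: l) u = ‖x - u‖ ^ 2 * listWeight l u := by
  simp [listWeight]

lemma listDet_eigBlk (l : List (ℂ × ℝ)) (x : ℂ) (q w : Fin n → ℂ) (B : Fin n → Fin n → ℂ) :
    listDet l (eigBlk x q w B) = listWeight l x * listDet l B := by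
  rw [listDet, listDet, listWeight, ← List.prod_map_mul]
  congr 1
  refine List.map_congr_left fun p _ => ?_
  rw [charDet_eigBlk, norm_mul, Real.mul_rpow (norm_nonneg _) (norm_nonneg _)]

lemma charDet_conjEquiv {S : Matrix (Fin n) (Fin n) ℂ} (hS : IsUnit S.det) (x : ℂ)
    (B : Fin n → Fin n → ℂ) : charDet x (conjEquiv hS B) = charDet x B := by
  have h : x • (1 : Matrix (Fin n) (Fin n) ℂ) - of (conjEquiv hS B) =
      S * (x • (1 : Matrix (Fin n) (Fin n) ℂ) - of B) * S⁻¹ := by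
    rw [Matrix.mul_sub, Matrix.sub_mul, Matrix.mul_smul, Matrix.mul_one, Matrix.smul_mul,
      mul_nonsing_inv S hS]
    rfl
  rw [charDet, h, det_conj ((isUnit_iff_isUnit_det _).2 hS)]
  rfl

lemma listDet_conjEquiv {S : Matrix (Fin n) (Fin n) ℂ} (hS : IsUnit S.det) (l : List (ℂ × ℝ))
    (B : Fin n → Fin n → ℂ) : listDet l (conjEquiv hS B) = listDet l B := by
  simp only [listDet, charDet_conjEquiv]

lemma measurable_listDet (l : List (ℂ × ℝ)) : Measurable fun A : Fin n → Fin n → ℂ =>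
    listDet l A := by
  induction l with
  | nil => simp [listDet]
  | cons p l ih =>
    simp only [listDet, List.map_cons, List.prod_cons] at ih ⊢
    have := measurable_charDet_comp (n := n) (measurable_const (a := p.1)) measurable_id
    exact (this.norm.pow_const _).mul ih

lemma measurable_listDet_cons (l : List (ℂ × ℝ)) :
    Measurable fun p : ℂ × (Fin n → Fin n → ℂ) => listDet ((p.1, 2) :: l) p.2 := by
  simp_rw [listDet_cons_two]
  exact (continuous_charDet_prod.measurable.norm.pow_const 2).mul
    ((measurable_listDet l).comp measurable_snd)

lemma measurable_listWeight (l : List (ℂ × ℝ)) : Measurable (listWeight l) := by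
  induction l with
  | nil =>
    have : listWeight [] = fun _ => 1 := by ext; simp [listWeight]
    rw [this]
    exact measurable_const
  | cons p l ih =>
    have : listWeight (p :: l) = fun u => ‖p.1 - u‖ ^ p.2 * listWeight l u := by
      ext; simp [listWeight]
    rw [this]
    fun_prop

lemma measurable_listJoint (l : List (ℂ × ℝ)) : Measurable (listJoint (n := n) l) := by
  have := measurable_listWeight l
  unfold listJoint
  fun_prop

/-- Separating the first point turns its Vandermonde factors into a new pair (x, 2), just as the
Jacobian |det(x - B)|² does on the matrix side. This is why the test functions are products over
lists: the class is closed under the induction step. -/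
lemma listJoint_cons (l : List (ℂ × ℝ)) (x : ℂ) (u : Fin n → ℂ) :
    listJoint l (Fin.cons x u : Fin (n + 1) → ℂ) =
      listWeight l x * Real.exp (-‖x‖ ^ 2) * listJoint ((x, 2) :: l) u := by
  simp only [listJoint, Fin.prod_univ_succ, Fin.cons_zero, Fin.cons_succ, listWeight_cons_two]
  have h0 : ∏ j ∈ Finset.Ioi (0 : Fin (n + 1)), ‖(Fin.cons x u : Fin (n + 1) → ℂ) j - x‖ ^ 2 =
      ∏ i, ‖x - u i‖ ^ 2 := by
    rw [Fin.prod_Ioi_zero]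
    refine Finset.prod_congr rfl fun i _ => ?_
    rw [Fin.cons_succ, norm_sub_rev]
  have hs : ∀ i : Fin n, ∏ j ∈ Finset.Ioi i.succ, ‖(Fin.cons x u : Fin (n + 1) → ℂ) j - u i‖ ^ 2 =
      ∏ j ∈ Finset.Ioi i, ‖u j - u i‖ ^ 2 := by
    intro i
    rw [Fin.prod_Ioi_succ]
    simp only [Fin.cons_succ]
  simp only [h0, hs, Finset.prod_mul_distrib]
  ring

/-- One step of the reduction: `∫ κ(q) dq` collects the eigenvector. -/
lemma exists_lintegral_listDet_succ (n : ℕ) : ∃ K : ℝ≥0∞, ∀ l : List (ℂ × ℝ),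
    ((n + 1 : ℕ) : ℝ≥0∞) * ∫⁻ A : Fin (n + 1) → Fin (n + 1) → ℂ,
        ENNReal.ofReal (listDet l A) * gaussDensity A =
      K * ∫⁻ x : ℂ, ENNReal.ofReal (listWeight l x * Real.exp (-‖x‖ ^ 2)) *
        ∫⁻ B : Fin n → Fin n → ℂ, ENNReal.ofReal (listDet ((x, 2) :: l) B) * gaussDensity B := by
  choose κ hκ using exists_lintegral_gaussDensity_eigBlk (n := n)
  -- The function κ comes from a choice; taking x = 0 and G = 1 exhibits it as a quotient of
  -- integrals measurable in q.
  have hκm : Measurable κ := by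
    have h1 : ∀ q, κ q = (∫⁻ w : Fin n → ℂ, ∫⁻ B, gaussDensity (eigBlk 0 q w B)) /
        ∫⁻ B, gaussDensity (n := n) B := by
      intro q
      have h := hκ q 0 (fun _ => 1) measurable_const fun _ _ _ => rfl
      simp only [one_mul, norm_zero, ne_eq, OfNat.ofNat_ne_zero, not_false_eq_true, zero_pow,
        neg_zero, Real.exp_zero, ENNReal.ofReal_one] at h
      rw [h, ENNReal.mul_div_cancel_right lintegral_gaussDensity_ne_zero
        lintegral_gaussDensity_ne_top]
    have h2 : Measurable fun p : ((Fin n → ℂ) × (Fin n → ℂ)) × (Fin n → Fin n → ℂ) =>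
        gaussDensity (eigBlk 0 p.1.1 p.1.2 p.2) :=
      measurable_gaussDensity.comp (measurable_eigBlk_comp (by fun_prop) (by fun_prop)
        (by fun_prop) (by fun_prop))
    rw [funext h1]
    exact (h2.lintegral_prod_right'.lintegral_prod_right').div_const _
  refine ⟨∫⁻ q, κ q, fun l => ?_⟩
  have hYm : Measurable fun x : ℂ => ENNReal.ofReal (listWeight l x * Real.exp (-‖x‖ ^ 2)) *
      ∫⁻ B : Fin n → Fin n → ℂ, ENNReal.ofReal (listDet ((x, 2) :: l) B) * gaussDensity B := by
    have h1 : Measurable fun p : ℂ × (Fin n → Fin n → ℂ) =>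
        ENNReal.ofReal (listDet ((p.1, 2) :: l) p.2) * gaussDensity p.2 :=
      (measurable_listDet_cons l).ennreal_ofReal.mul (measurable_gaussDensity.comp measurable_snd)
    have h2 := measurable_listWeight l
    exact Measurable.mul (by fun_prop) h1.lintegral_prod_right'
  rw [lintegral_eigBlk (fun A => ENNReal.ofReal (listDet l A) * gaussDensity A)
    ((measurable_listDet l).ennreal_ofReal.mul measurable_gaussDensity),
    ← lintegral_const_mul _ hYm]
  refine lintegral_congr fun x => ?_
  rw [← lintegral_mul_const _ hκm]
  refine lintegral_congr fun q => ?_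
  have hpt : ∀ w B, ENNReal.ofReal (‖charDet x B‖ ^ 2) *
      (ENNReal.ofReal (listDet l (eigBlk x q w B)) * gaussDensity (eigBlk x q w B)) =
      ENNReal.ofReal (listWeight l x) *
        (ENNReal.ofReal (listDet ((x, 2) :: l) B) * gaussDensity (eigBlk x q w B)) := by
    intro w B
    rw [listDet_eigBlk, listDet_cons_two, ENNReal.ofReal_mul (listWeight_nonneg l x),
      ENNReal.ofReal_mul (by positivity)]
    ring
  simp_rw [hpt, lintegral_const_mul' _ _ ENNReal.ofReal_ne_top]
  rw [hκ q x _ (measurable_listDet _).ennreal_ofReal fun S hS B => by rw [listDet_conjEquiv],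
    ENNReal.ofReal_mul (listWeight_nonneg l x)]
  ring

/-- The eigenvalue distribution of the complex Ginibre ensemble, up to normalisation and tested
against products of powers of characteristic polynomials. -/
theorem exists_lintegral_listDet (n : ℕ) : ∃ C : ℝ≥0∞, ∀ l : List (ℂ × ℝ),
    ∫⁻ A : Fin n → Fin n → ℂ, ENNReal.ofReal (listDet l A) * gaussDensity A =
      C * ∫⁻ u : Fin n → ℂ, ENNReal.ofReal (listJoint l u) := by
  induction n with
  | zero =>
    refine ⟨1, fun l => ?_⟩
    have h1 : ∀ A : Fin 0 → Fin 0 → ℂ, ENNReal.ofReal (listDet l A) * gaussDensity A = 1 := by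
      intro A
      have : listDet l A = 1 := by simp [listDet, charDet]
      simp [this, gaussDensity, frobSq]
    have h2 : ∀ u : Fin 0 → ℂ, ENNReal.ofReal (listJoint l u) = 1 := by
      intro u
      simp [listJoint]
    simp only [h1, h2, one_mul, lintegral_const, volume_pi, Measure.pi_univ, Finset.univ_eq_empty,
      Finset.prod_empty]
  | succ n ih =>
    obtain ⟨C, hC⟩ := ih
    obtain ⟨K, hK⟩ := exists_lintegral_listDet_succ n
    refine ⟨((n + 1 : ℕ) : ℝ≥0∞)⁻¹ * (K * C), fun l => ?_⟩
    have h0 : ((n + 1 : ℕ) : ℝ≥0∞) ≠ 0 := by exact_mod_cast n.succ_ne_zero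
    have hjm : Measurable fun u : Fin (n + 1) → ℂ => ENNReal.ofReal (listJoint l u) :=
      (measurable_listJoint l).ennreal_ofReal
    have hjm' := hjm.comp (measurePreserving_cons (n := n) ℂ).measurable
    have hright : ∫⁻ u : Fin (n + 1) → ℂ, ENNReal.ofReal (listJoint l u) =
        ∫⁻ x : ℂ, ENNReal.ofReal (listWeight l x * Real.exp (-‖x‖ ^ 2)) *
          ∫⁻ u : Fin n → ℂ, ENNReal.ofReal (listJoint ((x, 2) :: l) u) := by
      rw [← (measurePreserving_cons (n := n) ℂ).lintegral_comp hjm]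
      refine (lintegral_prod _ hjm'.aemeasurable).trans ?_
      refine lintegral_congr fun x => ?_
      rw [← lintegral_const_mul' _ _ ENNReal.ofReal_ne_top]
      refine lintegral_congr fun u => ?_
      change ENNReal.ofReal (listJoint l (Fin.cons x u : Fin (n + 1) → ℂ)) = _
      rw [listJoint_cons]
      exact ENNReal.ofReal_mul (mul_nonneg (listWeight_nonneg l x) (Real.exp_pos _).le)
    have hmeas : Measurable fun x : ℂ => ENNReal.ofReal (listWeight l x * Real.exp (-‖x‖ ^ 2)) *
          ∫⁻ u : Fin n → ℂ, ENNReal.ofReal (listJoint ((x, 2) :: l) u) := by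
      have h1 : Measurable fun p : ℂ × (Fin n → ℂ) =>
          ENNReal.ofReal (listJoint ((p.1, 2) :: l) p.2) := by
        have := measurable_listWeight l
        simp only [listJoint, listWeight_cons_two]
        fun_prop
      have h2 := measurable_listWeight l
      exact Measurable.mul (by fun_prop) h1.lintegral_prod_right'
    rw [hright, mul_assoc, mul_assoc, ← lintegral_const_mul C hmeas]
    have hstep := hK l
    simp_rw [hC, mul_left_comm _ C] at hstep
    rw [← hstep, ← mul_assoc, ENNReal.inv_mul_cancel h0 (ENNReal.natCast_ne_top _), one_mul]

end GinibreEigenvalues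

/-! ### The law of the matrix entries as a density. -/

section GaussianMeasure

open scoped ENNReal

lemma lintegral_pi_prod_ofReal {ι E : Type*} [Fintype ι] [MeasurableSpace E] (μ : ι → Measure E)
    [∀ i, SigmaFinite (μ i)] {f : E → ℝ} (hf : ∀ i, Integrable f (μ i)) (h0 : ∀ x, 0 ≤ f x) :
    ∫⁻ x : ι → E, ENNReal.ofReal (∏ i, f (x i)) ∂Measure.pi μ =
      ∏ i, ∫⁻ x, ENNReal.ofReal (f x) ∂μ i := by
  rw [← ofReal_integral_eq_lintegral_ofReal (Integrable.fintype_prod_dep (f := fun _ => f) hf)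
    (ae_of_all _ fun x => Finset.prod_nonneg fun i _ => h0 _),
    integral_fintype_prod_eq_prod (fun _ => f), ENNReal.ofReal_prod_of_nonneg fun i _ =>
      integral_nonneg h0]
  exact Finset.prod_congr rfl fun i _ =>
    ofReal_integral_eq_lintegral_ofReal (hf i) (ae_of_all _ h0)

lemma pi_withDensity_ofReal {ι E : Type*} [Fintype ι] [MeasurableSpace E] (μ : Measure E)
    [SigmaFinite μ] {f : E → ℝ} (hf : Integrable f μ) (h0 : ∀ x, 0 ≤ f x) :
    Measure.pi (fun _ : ι => μ.withDensity fun x => ENNReal.ofReal (f x)) =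
      (Measure.pi fun _ : ι => μ).withDensity fun x => ENNReal.ofReal (∏ i, f (x i)) := by
  have : IsFiniteMeasure (μ.withDensity fun x => ENNReal.ofReal (f x)) :=
    isFiniteMeasure_withDensity_ofReal hf.2
  refine Measure.pi_eq fun s hs => ?_
  rw [withDensity_apply _ (MeasurableSet.univ_pi hs), Measure.restrict_pi_pi,
    lintegral_pi_prod_ofReal _ (fun i => hf.restrict) h0]
  exact Finset.prod_congr rfl fun i _ => (withDensity_apply _ (hs i)).symm

lemma measurePreserving_uncurry {ι κ E : Type*} [Fintype ι] [Fintype κ] [MeasureSpace E]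
    [SigmaFinite (volume : Measure E)] :
    MeasurePreserving fun (A : ι → κ → E) (p : ι × κ) => A p.1 p.2 := by
  have hm : Measurable fun (A : ι → κ → E) (p : ι × κ) => A p.1 p.2 := by fun_prop
  refine ⟨hm, ?_⟩
  rw [volume_pi (ι := ι × κ)]
  refine (Measure.pi_eq fun s hs => ?_).symm
  have hpre : (fun (A : ι → κ → E) (p : ι × κ) => A p.1 p.2) ⁻¹' Set.univ.pi s =
      Set.univ.pi fun i => Set.univ.pi fun j => s (i, j) := by
    ext A
    simp [Set.mem_pi, Prod.forall]
  rw [Measure.map_apply hm (MeasurableSet.univ_pi hs), hpre, volume_pi_pi, Fintype.prod_prod_type]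
  exact Finset.prod_congr rfl fun i _ => volume_pi_pi _

lemma lintegral_stdComplexNormal :
    ∫⁻ z : ℂ, ENNReal.ofReal (Real.pi⁻¹ * Real.exp (-‖z‖ ^ 2)) = 1 := by
  rw [← ofReal_integral_eq_lintegral_ofReal (integrable_exp_neg_norm_sq.const_mul _)
    (ae_of_all _ fun z => by positivity), integral_const_mul]
  have h := Complex.integral_exp_neg_rpow (p := 2) (by norm_num)
  simp only [Real.rpow_two] at h
  rw [h]
  norm_num [Real.pi_ne_zero]

instance isProbabilityMeasure_stdComplexNormal : IsProbabilityMeasure stdComplexNormal :=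
  ⟨by rw [stdComplexNormal, withDensity_apply _ MeasurableSet.univ, Measure.restrict_univ,
    lintegral_stdComplexNormal]⟩

instance isProbabilityMeasure_gaussianEntries (N : ℕ) :
    IsProbabilityMeasure (gaussianEntries N) := by
  unfold gaussianEntries
  infer_instance

lemma lintegral_gaussianEntries {N : ℕ} (Φ : (Fin N × Fin N → ℂ) → ℝ≥0∞) (hΦ : Measurable Φ) :
    ∫⁻ g, Φ g ∂gaussianEntries N = ENNReal.ofReal (Real.pi⁻¹ ^ (N * N)) *
      ∫⁻ A : Fin N → Fin N → ℂ, Φ (fun p => A p.1 p.2) * gaussDensity A := by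
  have hdens : Measurable fun g : Fin N × Fin N → ℂ =>
      ENNReal.ofReal (∏ p, Real.pi⁻¹ * Real.exp (-‖g p‖ ^ 2)) := by fun_prop
  rw [gaussianEntries, stdComplexNormal,
    pi_withDensity_ofReal volume (integrable_exp_neg_norm_sq.const_mul _) fun z => by positivity,
    lintegral_withDensity_eq_lintegral_mul _ hdens hΦ, ← volume_pi,
    ← measurePreserving_uncurry.lintegral_comp (hdens.mul hΦ),
    ← lintegral_const_mul' _ _ ENNReal.ofReal_ne_top]
  refine lintegral_congr fun A => ?_
  simp only [Pi.mul_apply]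
  rw [Finset.prod_mul_distrib, Finset.prod_const, Finset.card_univ, Fintype.card_prod,
    Fintype.card_fin, ENNReal.ofReal_mul (by positivity), Fintype.prod_prod_type, gaussDensity,
    exp_neg_frobSq]
  ring

end GaussianMeasure

/-! ### Moments of the characteristic polynomial and the final assembly. -/

section Moment

open scoped ENNReal

lemma measurable_absDetPow (N : ℕ) (γ : ℝ) (x : ℂ) : Measurable (absDetPow N γ x) := by
  have hc : Continuous fun g : Fin N × Fin N → ℂ =>
      ginibreMatrix N g - x • (1 : Matrix (Fin N) (Fin N) ℂ) := by
    refine Continuous.sub ?_ continuous_const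
    exact continuous_matrix fun i j => by
      simp only [ginibreMatrix, Matrix.of_apply]
      fun_prop
  exact hc.matrix_det.measurable.norm.pow_const γ

lemma absDetPow_eq_listDet {N : ℕ} (hN : 1 ≤ N) (γ : ℝ) (x : ℂ) (A : Fin N → Fin N → ℂ) :
    absDetPow N γ x (fun p => A p.1 p.2) =
      ((Real.sqrt N)⁻¹ ^ N) ^ γ * listDet [((Real.sqrt N : ℂ) * x, γ)] A := by
  have hs : 0 < Real.sqrt N := Real.sqrt_pos.2 (by exact_mod_cast hN)
  have hsC : (Real.sqrt N : ℂ) ≠ 0 := by exact_mod_cast hs.ne'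
  have h : ginibreMatrix N (fun p => A p.1 p.2) - x • (1 : Matrix (Fin N) (Fin N) ℂ) =
      (-(Real.sqrt N : ℂ)⁻¹) •
        (((Real.sqrt N : ℂ) * x) • (1 : Matrix (Fin N) (Fin N) ℂ) - Matrix.of A) := by
    ext i j
    simp only [ginibreMatrix, Matrix.sub_apply, Matrix.of_apply, Matrix.smul_apply, smul_eq_mul]
    field_simp
    ring
  rw [absDetPow, h, Matrix.det_smul, Fintype.card_fin, ← charDet, norm_mul,
    Real.mul_rpow (norm_nonneg _) (norm_nonneg _)]
  simp [listDet, abs_of_pos hs]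

lemma listJoint_smul {N : ℕ} (γ : ℝ) (x : ℂ) (v : Fin N → ℂ) :
    listJoint [((Real.sqrt N : ℂ) * x, γ)] (Real.sqrt N • v) =
      ((Real.sqrt N ^ N) ^ γ * ∏ i : Fin N, ∏ _j ∈ Finset.Ioi i, (N : ℝ)) *
        ginibreEigenIntegrand N γ x v := by
  have h0 : (0 : ℝ) ≤ N := Nat.cast_nonneg N
  have hs : 0 ≤ Real.sqrt N := Real.sqrt_nonneg _
  have h1 : ∀ i, listWeight [((Real.sqrt N : ℂ) * x, γ)] ((Real.sqrt N • v) i) =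
      Real.sqrt N ^ γ * ‖v i - x‖ ^ γ := by
    intro i
    simp only [listWeight, List.map_cons, List.map_nil, List.prod_cons, List.prod_nil, mul_one,
      Pi.smul_apply, Complex.real_smul]
    rw [← mul_sub, norm_mul, Complex.norm_real, Real.norm_of_nonneg hs,
      Real.mul_rpow hs (norm_nonneg _), norm_sub_rev]
  have h2 : ∀ i, Real.exp (-‖(Real.sqrt N • v) i‖ ^ 2) =
      Real.exp (-(N : ℝ) * ginibrePotential (v i)) := by
    intro i
    rw [Pi.smul_apply, norm_smul, Real.norm_of_nonneg hs, mul_pow, Real.sq_sqrt h0,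
      ginibrePotential, neg_mul]
  have h3 : ∀ i j, ‖(Real.sqrt N • v) j - (Real.sqrt N • v) i‖ ^ 2 = N * ‖v j - v i‖ ^ 2 := by
    intro i j
    rw [Pi.smul_apply, Pi.smul_apply, ← smul_sub, norm_smul, Real.norm_of_nonneg hs, mul_pow,
      Real.sq_sqrt h0]
  have h4 : (Real.sqrt N ^ N) ^ γ = (Real.sqrt N ^ γ) ^ N := by
    rw [← Real.rpow_natCast, ← Real.rpow_natCast, ← Real.rpow_mul hs, ← Real.rpow_mul hs, mul_comm]
  simp only [listJoint, h1, h2, h3, ginibreEigenIntegrand, weight, Finset.prod_mul_distrib, h4,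
    Finset.prod_const, Finset.card_univ, Fintype.card_fin]
  ring

lemma ginibreEigenIntegrand_nonneg (N : ℕ) (γ : ℝ) (x : ℂ) (v : Fin N → ℂ) :
    0 ≤ ginibreEigenIntegrand N γ x v := by
  unfold ginibreEigenIntegrand weight
  positivity

lemma ginibreEigenIntegrand_zero (N : ℕ) (x : ℂ) :
    ginibreEigenIntegrand N 0 x = weight N ginibrePotential := by
  ext v
  simp [ginibreEigenIntegrand]

/-- Moments of the characteristic polynomial are proportional to eigenvalue integrals, with a
constant that does not depend on the exponent. -/
lemma exists_lintegral_absDetPow {N : ℕ} (hN : 1 ≤ N) (x : ℂ) : ∃ k Q : ℝ≥0∞, k ≠ 0 ∧ k ≠ ∞ ∧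
    ∀ γ : ℝ, k * ∫⁻ g, ENNReal.ofReal (absDetPow N γ x g) ∂gaussianEntries N =
      Q * ∫⁻ v, ENNReal.ofReal (ginibreEigenIntegrand N γ x v) := by
  have hs : 0 < Real.sqrt N := Real.sqrt_pos.2 (by exact_mod_cast hN)
  obtain ⟨C, hC⟩ := exists_lintegral_listDet N
  set e : (Fin N → ℂ) ≃ₗ[ℝ] (Fin N → ℂ) := LinearEquiv.smulOfNeZero ℝ _ (Real.sqrt N) hs.ne'
    with he
  have hdet : LinearMap.det (e : (Fin N → ℂ) →ₗ[ℝ] (Fin N → ℂ)) ≠ 0 :=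
    (LinearEquiv.isUnit_det' e).ne_zero
  set k := ENNReal.ofReal |(LinearMap.det (e : (Fin N → ℂ) →ₗ[ℝ] (Fin N → ℂ)))⁻¹| with hk
  set P : ℝ := ∏ i : Fin N, ∏ _j ∈ Finset.Ioi i, (N : ℝ) with hP
  refine ⟨k, ENNReal.ofReal (Real.pi⁻¹ ^ (N * N)) * C * ENNReal.ofReal P, ?_,
    ENNReal.ofReal_ne_top, fun γ => ?_⟩
  · rw [hk, ENNReal.ofReal_ne_zero_iff, abs_pos]
    exact inv_ne_zero hdet
  have hP0 : 0 ≤ P := by positivity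
  have hscale := lintegral_comp_linearMap (volume : Measure (Fin N → ℂ)) hdet
    (fun u => ENNReal.ofReal (listJoint [((Real.sqrt N : ℂ) * x, γ)] u))
    (measurable_listJoint _).ennreal_ofReal
  change ∫⁻ v : Fin N → ℂ, ENNReal.ofReal (listJoint [((Real.sqrt N : ℂ) * x, γ)]
    (Real.sqrt N • v)) = _ at hscale
  have hc1 : 0 ≤ (Real.sqrt N ^ N) ^ γ := by positivity
  simp_rw [listJoint_smul, ← hP, ENNReal.ofReal_mul (mul_nonneg hc1 hP0)] at hscale
  rw [lintegral_const_mul' _ _ ENNReal.ofReal_ne_top, ← hk, ENNReal.ofReal_mul hc1] at hscale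
  have hc2 : 0 ≤ ((Real.sqrt N)⁻¹ ^ N) ^ γ := by positivity
  rw [lintegral_gaussianEntries _ (measurable_absDetPow N γ x).ennreal_ofReal]
  simp_rw [absDetPow_eq_listDet hN, ENNReal.ofReal_mul hc2, mul_assoc]
  rw [lintegral_const_mul' _ _ ENNReal.ofReal_ne_top, hC]
  -- The γ-dependent powers of √N from rescaling the determinant and from rescaling the eigenvalues
  -- cancel, which leaves `k` and `Q` independent of γ.
  have hcc : ENNReal.ofReal (((Real.sqrt N)⁻¹ ^ N) ^ γ) *
      ENNReal.ofReal ((Real.sqrt N ^ N) ^ γ) = 1 := by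
    rw [← ENNReal.ofReal_mul hc2, ← Real.mul_rpow (by positivity) (by positivity), ← mul_pow,
      inv_mul_cancel₀ hs.ne', one_pow, Real.one_rpow, ENNReal.ofReal_one]
  set J := ∫⁻ v, ENNReal.ofReal (ginibreEigenIntegrand N γ x v)
  set I := ∫⁻ u : Fin N → ℂ, ENNReal.ofReal (listJoint [((Real.sqrt N : ℂ) * x, γ)] u)
  set a := ENNReal.ofReal (((Real.sqrt N)⁻¹ ^ N) ^ γ)
  set b := ENNReal.ofReal ((Real.sqrt N ^ N) ^ γ)
  calc k * (ENNReal.ofReal (Real.pi⁻¹ ^ (N * N)) * (a * (C * I)))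
      = ENNReal.ofReal (Real.pi⁻¹ ^ (N * N)) * (a * (C * (k * I))) := by ring
    _ = ENNReal.ofReal (Real.pi⁻¹ ^ (N * N)) * (C * (ENNReal.ofReal P * J)) * (a * b) := by
        rw [← hscale]; ring
    _ = _ := by rw [hcc]; ring

lemma partitionFunction_ginibre_pos {N : ℕ} (hN : 1 ≤ N) :
    0 < partitionFunction N ginibrePotential := by
  rw [partitionFunction_ginibre hN]
  have : (0 : ℝ) < N := by exact_mod_cast hN
  have : 0 < ∏ k ∈ Finset.Icc 1 N, (k.factorial : ℝ) :=
    Finset.prod_pos fun k _ => by exact_mod_cast k.factorial_pos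
  positivity

/-- At γ = 0 the expectation is 1 and the eigenvalue integral is the Ginibre partition function.
This shows that `Q` is neither 0 nor infinite and determines the ratio of the two constants. -/
lemma lintegral_absDetPow {N : ℕ} (hN : 1 ≤ N) {γ : ℝ} {x : ℂ}
    (hint : Integrable (ginibreEigenIntegrand N γ x)) :
    ∫⁻ g, ENNReal.ofReal (absDetPow N γ x g) ∂gaussianEntries N =
      ENNReal.ofReal ((∫ v, ginibreEigenIntegrand N γ x v) /
        partitionFunction N ginibrePotential) := by
  obtain ⟨k, Q, hk0, hk, h⟩ := exists_lintegral_absDetPow hN x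
  have hZ := partitionFunction_ginibre_pos hN
  have h1 := h 0
  have h2 := h γ
  rw [ginibreEigenIntegrand_zero, ← ofReal_integral_eq_lintegral_ofReal
    (weight_ginibre_integrable hN) (ae_of_all _ fun v => by
      rw [← ginibreEigenIntegrand_zero N x]
      exact ginibreEigenIntegrand_nonneg N 0 x v)] at h1
  change _ = Q * ENNReal.ofReal (partitionFunction N ginibrePotential) at h1
  simp only [absDetPow, Real.rpow_zero, ENNReal.ofReal_one, lintegral_const, measure_univ,
    mul_one] at h1
  rw [← ofReal_integral_eq_lintegral_ofReal hint
    (ae_of_all _ (ginibreEigenIntegrand_nonneg N γ x))] at h2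
  rw [ENNReal.ofReal_div_of_pos hZ, ENNReal.eq_div_iff (ENNReal.ofReal_pos.2 hZ).ne'
    ENNReal.ofReal_ne_top]
  have hQ : Q ≠ 0 := by
    rintro rfl
    rw [zero_mul] at h1
    exact hk0 h1
  have hQ' : Q ≠ ∞ := by
    rintro rfl
    rw [ENNReal.top_mul (ENNReal.ofReal_pos.2 hZ).ne'] at h1
    exact hk h1
  refine (ENNReal.mul_right_inj hQ hQ').1 ?_
  rw [← h2, h1]
  ring

lemma integrable_absDetPow {N : ℕ} (hN : 1 ≤ N) {γ : ℝ} {x : ℂ}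
    (hint : Integrable (ginibreEigenIntegrand N γ x)) :
    Integrable (absDetPow N γ x) (gaussianEntries N) := by
  rw [← lintegral_ofReal_ne_top_iff_integrable
    (measurable_absDetPow N γ x).aestronglyMeasurable
    (ae_of_all _ fun g => Real.rpow_nonneg (norm_nonneg _) _), lintegral_absDetPow hN hint]
  exact ENNReal.ofReal_ne_top

theorem ginibreMoment_eq {N : ℕ} (hN : 1 ≤ N) {γ : ℝ} {x : ℂ}
    (hint : Integrable (ginibreEigenIntegrand N γ x)) :
    ginibreMoment N γ x = (∫ v, ginibreEigenIntegrand N γ x v) /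
        partitionFunction N ginibrePotential := by
  have h0 : ∀ g, 0 ≤ absDetPow N γ x g := fun g => Real.rpow_nonneg (norm_nonneg _) _
  rw [ginibreMoment, integral_eq_lintegral_of_nonneg_ae (ae_of_all _ h0)
    (measurable_absDetPow N γ x).aestronglyMeasurable, lintegral_absDetPow hN hint,
    ENNReal.toReal_ofReal]
  exact div_nonneg (integral_nonneg (ginibreEigenIntegrand_nonneg N γ x))
    (partitionFunction_ginibre_pos hN).le

lemma sum_gammaExponent {d : ℕ} (hd : 1 ≤ d) :
    ∑ ℓ ∈ Finset.range d, gammaExponent d ℓ = 1 - d := by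
  have hd0 : (d : ℝ) ≠ 0 := by positivity
  simp only [gammaExponent]
  rw [← Finset.mul_sum, Finset.sum_sub_distrib, ← Finset.sum_div, Finset.sum_add_distrib,
    sum_fin_val_real]
  simp
  field_simp
  ring

theorem partitionFunction_lemniscate {N d : ℕ} (hN : 1 ≤ N) (hd : 1 ≤ d) (t : ℝ) :
    partitionFunction (N * d) (lemniscatePotential d t) =
      Real.exp (((N : ℝ) * t * d) ^ 2) * reductionConstant N d *
        partitionFunction N ginibrePotential ^ d *
        ∏ ℓ ∈ Finset.range d,
          ginibreMoment N (gammaExponent d ℓ) ((t * Real.sqrt d : ℝ) : ℂ) := by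
  have hd0 : (0 : ℝ) < d := by positivity
  have hZ := partitionFunction_ginibre_pos hN
  -- In the exponent of d, the 2N combines N from the factors 1/d of the block moments and N from
  -- the Jacobian of the affine substitution.
  have hterm : ∀ ℓ ∈ Finset.range d,
      (Real.exp (((N * d : ℕ) : ℝ) * t ^ 2) / d) ^ N *
          (shiftedPartition N (gammaExponent d ℓ) (N * d : ℕ) t / N.factorial) =
      (Real.exp (N * (((N * d : ℕ) : ℝ) * t ^ 2)) * (N.factorial : ℝ)⁻¹ *
        partitionFunction N ginibrePotential) *
        (d : ℝ) ^ (-((2 * N : ℝ) + N * (N - 1) / 2 + N / 2 * gammaExponent d ℓ)) *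
        ginibreMoment N (gammaExponent d ℓ) ((t * Real.sqrt d : ℝ) : ℂ) := by
    intro ℓ _
    rw [ginibreMoment_eq hN (integrable_ginibreEigenIntegrand hN hd (gammaExponent_gt hd) t),
      shiftedPartition_eq hd, div_pow, ← Real.exp_nat_mul]
    have e : (d : ℝ) ^ (-((2 * N : ℝ) + N * (N - 1) / 2 + N / 2 * gammaExponent d ℓ)) =
        ((d : ℝ) ^ N)⁻¹ * (d : ℝ) ^ (-((N : ℝ) + N * (N - 1) / 2 + N * gammaExponent d ℓ / 2)) := by
      rw [← Real.rpow_natCast, ← Real.rpow_neg hd0.le, ← Real.rpow_add hd0]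
      congr 1
      ring
    rw [e]
    field_simp
  rw [partitionFunction_lemniscate_eq_prod hN hd, Finset.prod_congr rfl hterm,
    Finset.prod_mul_distrib, Finset.prod_mul_distrib, Finset.prod_const, Finset.card_range,
    ← Real.rpow_sum_of_pos hd0, reductionConstant, mul_pow, mul_pow, ← Real.exp_nat_mul]
  -- Since the γ_ℓ sum to 1 - d, the total power of d is the one in c_{N,d}.
  have e1 : ∑ ℓ ∈ Finset.range d, -((2 * N : ℝ) + N * (N - 1) / 2 + N / 2 * gammaExponent d ℓ) =
      -((N : ℝ) * (N * d + 2 * d + 1) / 2) := by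
    rw [Finset.sum_neg_distrib, Finset.sum_add_distrib, ← Finset.mul_sum, sum_gammaExponent hd]
    simp
    ring
  have e2 : (d : ℝ) * (N * (((N * d : ℕ) : ℝ) * t ^ 2)) = ((N : ℝ) * t * d) ^ 2 := by
    push_cast
    ring
  rw [e1, e2, inv_pow]
  ring

end Moment

end Lemniscate

theorem mainTheorem10 (N d : ℕ) (hN : 1 ≤ N) (hd : 1 ≤ d) (t : ℝ) :
    -- all integrals and expectations involved converge
    Integrable (Lemniscate.weight (N * d) (Lemniscate.lemniscatePotential d t)) ∧
    Integrable (Lemniscate.weight N Lemniscate.ginibrePotential) ∧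
    (∀ ℓ ∈ Finset.range d,
      Integrable
        (Lemniscate.absDetPow N (Lemniscate.gammaExponent d ℓ) ((t * Real.sqrt d : ℝ) : ℂ))
        (Lemniscate.gaussianEntries N)) ∧
    -- the factorisation
    Lemniscate.partitionFunction (N * d) (Lemniscate.lemniscatePotential d t) =
      Real.exp (((N : ℝ) * t * d) ^ 2) * Lemniscate.reductionConstant N d *
        Lemniscate.partitionFunction N Lemniscate.ginibrePotential ^ d *
        ∏ ℓ ∈ Finset.range d,
          Lemniscate.ginibreMoment N (Lemniscate.gammaExponent d ℓ)
            ((t * Real.sqrt d : ℝ) : ℂ) ∧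
    -- the explicit value of the Ginibre partition function
    Lemniscate.partitionFunction N Lemniscate.ginibrePotential =
      Real.pi ^ N * (∏ k ∈ Finset.Icc 1 N, (k.factorial : ℝ)) /
        (N : ℝ) ^ ((N : ℝ) * (N + 1) / 2) := by
  exact ⟨Lemniscate.weight_lemniscate_integrable hN hd t, Lemniscate.weight_ginibre_integrable hN,
    fun ℓ _ => Lemniscate.integrable_absDetPow hN (Lemniscate.integrable_ginibreEigenIntegrand hN hd
      (Lemniscate.gammaExponent_gt hd) t),
    Lemniscate.partitionFunction_lemniscate hN hd t, Lemniscate.partitionFunction_ginibre hN⟩
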